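/- Let $M$ and $N$ be complex manifolds of dimensions $m=\dim_{\mathbb C}M\ge 1$ and $n=\dim_{\mathbb C}N$, with $m\le n$ and $M$ compact, let $g$ and $h$ be (smooth) Hermitian metrics on $M$ and $N$, and let $f\colon M\to N$ be a holomorphic map. **Curvature.** For a Hermitian metric $g$ on $M$, in local holomorphic coordinates, the Chern curvature tensor is $$R_{i\bar jk\bar l}=-\frac{\partial^2 g_{k\bar l}}{\partial z^i\partial\bar z^j}+\sum_{p,q}g^{p\bar q}\frac{\partial g_{k\bar q}}{\partial z^i}\frac{\partial g_{p\bar l}}{\partial\bar z^j},$$ and the Chern scalar curvature is $S=\sum g^{i\bar j}g^{k\bar l}R_{i\bar jk\bar l}$. For an $\ell$-dimensional subspace $\Sigma\subset T'_pM$ with unitary basis $E_1,\dots,E_\ell$ and $v\in\Sigma$ put $$Ric^{(1)}_\ell(p,\Sigma)(v,\bar v)=\sum_{i=1}^{\ell}R(v,\bar v,E_i,\overline{E_i}),\qquad Ric^{(2)}_\ell(p,\Sigma)(v,\bar v)=\sum_{i=1}^{\ell}R(E_i,\overline{E_i},v,\bar v),$$ $$S_\ell(p,\Sigma)=\sum_{i,j=1}^{\ell}R(E_i,\overline{E_i},E_j,\overline{E_j}).$$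 For a real constant $c$, "$Ric_\ell^{(1)}\le c$" means $Ric^{(1)}_\ell(p,\Sigma)(v,\bar v)\le c|v|^2$ for all points $p$, all $\ell$-dimensional $\Sigma\subset T'_p$ and all $v\in\Sigma$; similarly for "$Ric_\ell^{(2)}\ge c$"; "$S_\ell\ge c$" means $S_\ell(p,\Sigma)\ge c$ for all $p$ and $\Sigma$. The real bisectional curvature satisfies $\widetilde B\le c$ if $\widetilde B(e,a)=|a|^{-2}\sum_{i,j}R(e_i,\overline{e_i},e_j,\overline{e_j})a_ia_j\le c$ for every unitary frame $e$ of the holomorphic tangent space at any point and every tuple $a\neq0$ of nonnegative real numbers $a_i$. The same definitions apply to $(N,h)$. **Quantities attached to $f$.** With $A_{\alpha\bar\beta}$ the components of $f^*h$ in local holomorphic coordinates of $M$, $\frac{(f^*h)^m}{g^m}=\frac{\det(A_{\alpha\bar\beta})}{\det(g_{\alpha\bar\beta})}$. Further, $$\|\wedge^\ell\partial f\|_0(x)=\sup\Big\{\frac{|\partial f(v_1)\wedge\dots\wedge\partial f(v_\ell)|}{|v_1\wedge\dots\wedge v_\ell|} : v_1,\dots,v_\ell\in T'_xM,\ v_1\wedge\dots\wedge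 v_\ell\ne0\Big\},$$ where $|v_1\wedge\dots\wedge v_\ell|^2=\det\big(g(v_i,\overline{v_j})\big)$, and likewise with $h$ on $N$. Finally $\sigma_\ell(x)=\sum_{\alpha=1}^{\ell}|\lambda_\alpha|^2(x)$, where $|\lambda_1|\ge\dots\ge|\lambda_m|$ are the singular values of $\partial f\colon(T'_xM,g)\to(T'_{f(x)}N,h)$. **Theorem.** Let $K\ge0$ and $\kappa>0$ be real numbers. (a) If $S\ge-K$ on $(M,g)$ and $Ric_m^{(1)}\le-\kappa$ on $(N,h)$, then for all $x\in M$ $$\frac{(f^*h)^m}{g^m}(x)\le\Big(\frac{K}{m\kappa}\Big)^m.$$ (b) Let $1\le\ell<m$ and let $g$ be Kähler, i.e. $\omega=\sqrt{-1}\sum g_{i\bar j}\,dz^i\wedge d\bar z^j$ satisfies $d\omega=0$. If $S_\ell\ge-K$ on $(M,g)$ and $Ric_\ell^{(1)}\le-\kappa$ on $(N,h)$, then for all $x\in M$ $$\|\wedge^\ell\partial f\|_0^2(x)\le\Big(\frac{K}{\ell\kappa}\Big)^\ell.$$ (c) Let $1\le\ell\le m$. If $Ric_\ell^{(2)}\ge-K$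 on $(M,g)$ and $\widetilde B\le-\kappa$ on $(N,h)$, then for all $x\in M$ $$\sigma_\ell(x)\le\frac{\ell K}{\kappa}.$$ -/

import Mathlib

open scoped Manifold ContDiff

noncomputable section

namespace HermitianGeometry

/-- The model space `ℂᵐ` of a complex manifold of dimension `m`. -/
abbrev Cn (m : ℕ) : Type := EuclideanSpace ℂ (Fin m)

/-- The holomorphic tangent space `T'ₓM` of a complex manifold `M` of dimension `m`: the tangent
space over `ℂ`, a complex vector space of dimension `m`. -/
abbrev T (m : ℕ) {M : Type*} [TopologicalSpace M] [ChartedSpace (Cn m) M] (x : M) : Type :=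
  TangentSpace 𝓘(ℂ, Cn m) x

/-- The coordinate vector `∂/∂zⁱ` of the chart `φ`, at the point with coordinates `z`. -/
def coordVec {m : ℕ} {M : Type*} [TopologicalSpace M] [ChartedSpace (Cn m) M]
    (φ : OpenPartialHomeomorph M (Cn m)) (z : Cn m) (i : Fin m) : T m (φ.symm z) :=
  mfderiv 𝓘(ℂ, Cn m) 𝓘(ℂ, Cn m) φ.symm z (EuclideanSpace.single i (1 : ℂ) : Cn m)

/-- A (smooth) Hermitian metric on a complex manifold: `inner x u v` is `g(u, v̄)`, linear in `u`
and conjugate linear in `v`. Smoothness (as real functions) is that of the components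
`g_{i j̄}` in all charts. -/
structure HermitianMetric (m : ℕ) (M : Type*) [TopologicalSpace M] [ChartedSpace (Cn m) M] where
  inner : ∀ x : M, T m x →ₗ[ℂ] T m x →ₗ⋆[ℂ] ℂ
  conj_symm : ∀ (x : M) (u v : T m x), starRingEnd ℂ (inner x v u) = inner x u v
  pos : ∀ (x : M) (u : T m x), u ≠ 0 → 0 < (inner x u u).re
  smooth : ∀ φ ∈ atlas (Cn m) M, ∀ i j : Fin m,
    ContDiffOn ℝ ∞ (fun z => inner (φ.symm z) (coordVec φ z i) (coordVec φ z j)) φ.target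

/-- The Wirtinger derivative `∂F/∂zⁱ`. -/
def dz {m : ℕ} (i : Fin m) (F : Cn m → ℂ) (z : Cn m) : ℂ :=
  (1 / 2 : ℂ) * (fderiv ℝ F z (EuclideanSpace.single i (1 : ℂ))
    - Complex.I * fderiv ℝ F z (EuclideanSpace.single i Complex.I))

/-- The Wirtinger derivative `∂F/∂z̄ⁱ`. -/
def dzbar {m : ℕ} (i : Fin m) (F : Cn m → ℂ) (z : Cn m) : ℂ :=
  (1 / 2 : ℂ) * (fderiv ℝ F z (EuclideanSpace.single i (1 : ℂ))
    + Complex.I * fderiv ℝ F z (EuclideanSpace.single i Complex.I))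

/-- The coordinate `zⁱ` on `ℂᵐ` as a real-linear form, that is, the constant 1-form `dzⁱ`. -/
def formDz {m : ℕ} (i : Fin m) : Cn m →L[ℝ] ℂ :=
  (EuclideanSpace.proj i : Cn m →L[ℂ] ℂ).restrictScalars ℝ

/-- The constant 1-form `dz̄ⁱ` on `ℂᵐ`. -/
def formDzbar {m : ℕ} (i : Fin m) : Cn m →L[ℝ] ℂ :=
  (Complex.conjCLE : ℂ →L[ℝ] ℂ).comp (formDz i)

/-- The wedge product `a ∧ b` of two 1-forms: `(a ∧ b)(u, v) = a(u) b(v) - a(v) b(u)`. -/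
def wedge {m : ℕ} (a b : Cn m →L[ℝ] ℂ) : Cn m [⋀^Fin 2]→L[ℝ] ℂ :=
  ContinuousMultilinearMap.alternatization
    ((ContinuousMultilinearMap.mkPiAlgebraFin ℝ 2 ℂ).compContinuousLinearMap ![a, b])

section Metric

variable {m : ℕ} {M : Type*} [TopologicalSpace M] [ChartedSpace (Cn m) M]

/-- The components `(uⁱ)` of a tangent vector `u` at `x`, `u = ∑ uⁱ ∂/∂zⁱ`, in the preferred
chart at `x`. -/
def comp (x : M) (u : T m x) (i : Fin m) : ℂ :=
  (show Cn m from mfderiv 𝓘(ℂ, Cn m) 𝓘(ℂ, Cn m) (chartAt (Cn m) x) x u) i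

namespace HermitianMetric

/-- The matrix `(g_{i j̄})` of the metric in the chart `φ`, at the point with coordinates `z`. -/
def matrix (g : HermitianMetric m M) (φ : OpenPartialHomeomorph M (Cn m)) (z : Cn m) :
    Matrix (Fin m) (Fin m) ℂ :=
  Matrix.of fun i j => g.inner (φ.symm z) (coordVec φ z i) (coordVec φ z j)

/-- The components `g^{i j̄}` of the inverse metric: `∑ⱼ g^{i j̄} g_{k j̄} = δᵢₖ`. -/
def inv (g : HermitianMetric m M) (φ : OpenPartialHomeomorph M (Cn m)) (z : Cn m)
    (i j : Fin m) : ℂ :=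
  (g.matrix φ z)⁻¹ j i

/-- The metric form `ω = √-1 ∑ g_{i j̄} dzⁱ ∧ dz̄ʲ` in the chart `φ`. -/
def metricForm (g : HermitianMetric m M) (φ : OpenPartialHomeomorph M (Cn m)) :
    Cn m → Cn m [⋀^Fin 2]→L[ℝ] ℂ :=
  fun z => ∑ i, ∑ j, (Complex.I * g.matrix φ z i j) • wedge (formDz i) (formDzbar j)

/-- The metric is Kähler: its metric form is closed, `dω = 0`. -/
def IsKahler (g : HermitianMetric m M) : Prop :=
  ∀ φ ∈ atlas (Cn m) M, ∀ z ∈ φ.target, extDeriv (g.metricForm φ) z = 0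

/-- The components of the Chern curvature tensor in the chart `φ`,
`R_{i j̄ k l̄} = - ∂²g_{k l̄}/∂zⁱ∂z̄ʲ + g^{p q̄} (∂g_{k q̄}/∂zⁱ) (∂g_{p l̄}/∂z̄ʲ)`. -/
def chernComp (g : HermitianMetric m M) (φ : OpenPartialHomeomorph M (Cn m)) (z : Cn m)
    (i j k l : Fin m) : ℂ :=
  - dz i (dzbar j fun w => g.matrix φ w k l) z
    + ∑ p, ∑ q, g.inv φ z p q * dz i (fun w => g.matrix φ w k q) z
        * dzbar j (fun w => g.matrix φ w p l) z

/-- The Chern curvature tensor `R(u, v̄, w, ȳ)` at `x` (computed in the preferred chart at `x`). -/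
def chern (g : HermitianMetric m M) (x : M) (u v w y : T m x) : ℂ :=
  ∑ i, ∑ j, ∑ k, ∑ l, g.chernComp (chartAt (Cn m) x) (chartAt (Cn m) x x) i j k l
    * comp x u i * starRingEnd ℂ (comp x v j) * comp x w k * starRingEnd ℂ (comp x y l)

/-- The Chern scalar curvature `S = g^{i j̄} g^{k l̄} R_{i j̄ k l̄}` (a real number). -/
def chernScalar (g : HermitianMetric m M) (x : M) : ℝ :=
  (∑ i, ∑ j, ∑ k, ∑ l, g.inv (chartAt (Cn m) x) (chartAt (Cn m) x x) i j
    * g.inv (chartAt (Cn m) x) (chartAt (Cn m) x x) k l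
    * g.chernComp (chartAt (Cn m) x) (chartAt (Cn m) x x) i j k l).re

/-- The vectors `e₁, …, e_ℓ` at `x` are unitary: `g(eᵢ, ēⱼ) = δᵢⱼ`. -/
def IsUnitary (g : HermitianMetric m M) (x : M) {l : ℕ} (e : Fin l → T m x) : Prop :=
  ∀ i j, g.inner x (e i) (e j) = if i = j then 1 else 0

/-- The vectors `e₁, …, e_ℓ` form a unitary basis of the subspace `V` of `T'ₓM`. -/
def IsUnitaryBasis (g : HermitianMetric m M) (x : M) {l : ℕ} (V : Submodule ℂ (T m x))
    (e : Fin l → T m x) : Prop :=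
  g.IsUnitary x e ∧ Submodule.span ℂ (Set.range e) = V

/-- `Ric_ℓ⁽¹⁾(x, V)(v, v̄) = ∑ᵢ R(v, v̄, eᵢ, ēᵢ)`, for a unitary basis `e` of `V`. -/
def firstRicci (g : HermitianMetric m M) (x : M) {l : ℕ} (e : Fin l → T m x) (v : T m x) : ℝ :=
  ∑ i, (g.chern x v v (e i) (e i)).re

/-- `Ric_ℓ⁽²⁾(x, V)(v, v̄) = ∑ᵢ R(eᵢ, ēᵢ, v, v̄)`, for a unitary basis `e` of `V`. -/
def secondRicci (g : HermitianMetric m M) (x : M) {l : ℕ} (e : Fin l → T m x) (v : T m x) : ℝ :=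
  ∑ i, (g.chern x (e i) (e i) v v).re

/-- `S_ℓ(x, V) = ∑ᵢⱼ R(eᵢ, ēᵢ, eⱼ, ēⱼ)`, for a unitary basis `e` of `V`. -/
def lScalar (g : HermitianMetric m M) (x : M) {l : ℕ} (e : Fin l → T m x) : ℝ :=
  ∑ i, ∑ j, (g.chern x (e i) (e i) (e j) (e j)).re

/-- `Ric_ℓ⁽¹⁾ ≤ c`: for all points `x`, all `ℓ`-dimensional `V ⊆ T'ₓM` and all `v ∈ V`,
`Ric_ℓ⁽¹⁾(x, V)(v, v̄) ≤ c |v|²`. -/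
def FirstRicciLE (g : HermitianMetric m M) (l : ℕ) (c : ℝ) : Prop :=
  ∀ (x : M) (V : Submodule ℂ (T m x)), Module.finrank ℂ V = l →
    ∀ e : Fin l → T m x, g.IsUnitaryBasis x V e →
      ∀ v ∈ V, g.firstRicci x e v ≤ c * (g.inner x v v).re

/-- `Ric_ℓ⁽²⁾ ≥ c`: for all points `x`, all `ℓ`-dimensional `V ⊆ T'ₓM` and all `v ∈ V`,
`Ric_ℓ⁽²⁾(x, V)(v, v̄) ≥ c |v|²`. -/
def SecondRicciGE (g : HermitianMetric m M) (l : ℕ) (c : ℝ) : Prop :=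
  ∀ (x : M) (V : Submodule ℂ (T m x)), Module.finrank ℂ V = l →
    ∀ e : Fin l → T m x, g.IsUnitaryBasis x V e →
      ∀ v ∈ V, c * (g.inner x v v).re ≤ g.secondRicci x e v

/-- `S_ℓ ≥ c`: `S_ℓ(x, V) ≥ c` for all points `x` and all `ℓ`-dimensional `V ⊆ T'ₓM`. -/
def LScalarGE (g : HermitianMetric m M) (l : ℕ) (c : ℝ) : Prop :=
  ∀ (x : M) (V : Submodule ℂ (T m x)), Module.finrank ℂ V = l →
    ∀ e : Fin l → T m x, g.IsUnitaryBasis x V e → c ≤ g.lScalar x e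

/-- The real bisectional curvature
`B̃(e, a) = |a|⁻² ∑ᵢⱼ R(eᵢ, ēᵢ, eⱼ, ēⱼ) aᵢ aⱼ` of a unitary frame `e` and `a ≠ 0`, `aᵢ ≥ 0`. -/
def realBisectional (g : HermitianMetric m M) (x : M) (e : Fin m → T m x) (a : Fin m → ℝ) : ℝ :=
  (1 / ∑ i, a i ^ 2) * ∑ i, ∑ j, (g.chern x (e i) (e i) (e j) (e j)).re * a i * a j

/-- The real bisectional curvature is `≤ c`. -/
def RealBisectionalLE (g : HermitianMetric m M) (c : ℝ) : Prop :=
  ∀ (x : M) (e : Fin m → T m x), g.IsUnitary x e →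
    ∀ a : Fin m → ℝ, (∀ i, 0 ≤ a i) → 0 < ∑ i, a i ^ 2 → g.realBisectional x e a ≤ c

/-- The norm `|v₁ ∧ ⋯ ∧ v_ℓ| = √ det (g(vᵢ, v̄ⱼ))` of a decomposable element of `∧^ℓ T'ₓM`. -/
def wedgeNorm (g : HermitianMetric m M) (x : M) {l : ℕ} (v : Fin l → T m x) : ℝ :=
  √ (Matrix.of fun i j => g.inner x (v i) (v j)).det.re

/-- The inner product on `T'ₓM` given by the metric, with the convention that the inner product
is conjugate linear in its first argument. -/
@[reducible]
def core (g : HermitianMetric m M) (x : M) : InnerProductSpace.Core ℂ (T m x) where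
  inner u v := g.inner x v u
  conj_inner_symm u v := g.conj_symm x v u
  re_inner_nonneg u := by
    by_cases hu : u = 0
    · subst hu; simp
    · exact (g.pos x u hu).le
  add_left u v w := by simp
  smul_left u v r := by simp
  definite u hu := by
    by_contra h
    have h1 := g.pos x u h
    have h2 : g.inner x u u = 0 := hu
    rw [h2] at h1
    simp at h1

end HermitianMetric

end Metric

/-- The singular values, in decreasing order, of a linear map between finite-dimensional complex
vector spaces with given inner products. -/
def singularValuesOf {V W : Type*} [AddCommGroup V] [Module ℂ V] [FiniteDimensional ℂ V]
    [AddCommGroup W] [Module ℂ W] [FiniteDimensional ℂ W]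
    (cV : InnerProductSpace.Core ℂ V) (cW : InnerProductSpace.Core ℂ W) (L : V →ₗ[ℂ] W) :
    ℕ →₀ ℝ :=
  letI : NormedAddCommGroup V := cV.toNormedAddCommGroup
  letI : InnerProductSpace ℂ V := InnerProductSpace.ofCore cV.toCore
  letI : NormedAddCommGroup W := cW.toNormedAddCommGroup
  letI : InnerProductSpace ℂ W := InnerProductSpace.ofCore cW.toCore
  LinearMap.singularValues L

section Maps

variable {m n : ℕ} {M N : Type*} [TopologicalSpace M] [ChartedSpace (Cn m) M]
  [TopologicalSpace N] [ChartedSpace (Cn n) N]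

/-- The tangent map `∂f : T'ₓM → T'_{f(x)}N`. -/
def tmap (f : M → N) (x : M) : T m x →ₗ[ℂ] T n (f x) :=
  (mfderiv 𝓘(ℂ, Cn m) 𝓘(ℂ, Cn n) f x).toLinearMap

/-- The matrix `A_{α β̄} = f*h(∂/∂z^α, ∂/∂z̄^β)` of the pulled back form `f*h` in the chart `φ`,
at the point with coordinates `z`. -/
def pullbackMatrix (h : HermitianMetric n N) (f : M → N)
    (φ : OpenPartialHomeomorph M (Cn m)) (z : Cn m) : Matrix (Fin m) (Fin m) ℂ :=
  Matrix.of fun a b => h.inner (f (φ.symm z))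
    (tmap f (φ.symm z) (coordVec φ z a)) (tmap f (φ.symm z) (coordVec φ z b))

/-- The ratio `(f*h)ᵐ / gᵐ = det (A_{α β̄}) / det (g_{α β̄})` of forms of top degree at `x`. -/
def volumeRatio (g : HermitianMetric m M) (h : HermitianMetric n N) (f : M → N) (x : M) : ℝ :=
  ((pullbackMatrix h f (chartAt (Cn m) x) (chartAt (Cn m) x x)).det
    / (g.matrix (chartAt (Cn m) x) (chartAt (Cn m) x x)).det).re

/-- `‖∧^ℓ ∂f‖₀(x)`, the supremum of `|∧^ℓ ∂f(a)| / |a|` over all decomposable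
`a = v₁ ∧ ⋯ ∧ v_ℓ ≠ 0` in `∧^ℓ T'ₓM`. -/
def wedgeMapNorm (g : HermitianMetric m M) (h : HermitianMetric n N) (f : M → N) (l : ℕ)
    (x : M) : ℝ :=
  sSup {r : ℝ | ∃ v : Fin l → T m x, exteriorPower.ιMulti ℂ l v ≠ 0 ∧
    r = h.wedgeNorm (f x) (fun i => tmap f x (v i)) / g.wedgeNorm x v}

/-- The singular values of `∂f : (T'ₓM, g) → (T'_{f(x)}N, h)` in decreasing order,
`|λ₁| ≥ ⋯ ≥ |λ_m| ≥ 0`, followed by zeros; `|λ_α|` is the value at `α - 1`. -/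
def singVal (g : HermitianMetric m M) (h : HermitianMetric n N) (f : M → N) (x : M) : ℕ →₀ ℝ :=
  haveI : FiniteDimensional ℂ (T m x) := inferInstanceAs (FiniteDimensional ℂ (Cn m))
  haveI : FiniteDimensional ℂ (T n (f x)) := inferInstanceAs (FiniteDimensional ℂ (Cn n))
  singularValuesOf (g.core x) (h.core (f x)) (tmap f x)

/-- `σ_ℓ(x) = |λ₁|² + ⋯ + |λ_ℓ|²`. -/
def sigma (g : HermitianMetric m M) (h : HermitianMetric n N) (f : M → N) (l : ℕ) (x : M) : ℝ :=
  ∑ a ∈ Finset.range l, singVal g h f x a ^ 2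

end Maps

end HermitianGeometry

/-!
Put `Φ = det` for (a), (b) and `Φ = trace` for (c). By compactness, `Φ` of the Gram matrix of `f*h`
attains its maximum over all unitary `ℓ`-frames of `M` at a frame `e₁, …, e_ℓ` over a point `x`,
which may be taken to diagonalize `f*h`, with eigenvalues `μ₁, …, μ_ℓ ≥ 0`, all positive in the
case of `det` unless the maximum is `0`; it suffices to bound `Φ` there. Extend the frame
holomorphically along a disc through `x` with tangent `v`, so that it is parallel at `x` to first
order. The mixed second derivative of its Gram matrix is then `-R(v, v̄, eᵢ, ēⱼ)` for `g`, while
for `f*h` it is minus the curvature of `h` plus second fundamental form terms, which Bessel's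
inequality shows to have the favourable sign. Comparing both along the disc at the maximum gives,
for the determinant, `∑ᵢ R^g(v, v̄, eᵢ, ēᵢ) ≤ ∑ᵢ R^h(∂f v, ∂f v̄, Eᵢ, Ēᵢ)` with
`Eᵢ = ∂f eᵢ / √μᵢ`, and for the trace
`∑ᵢ μᵢ R^g(v, v̄, eᵢ, ēᵢ) ≤ ∑ᵢ R^h(∂f v, ∂f v̄, ∂f eᵢ, ∂f ēᵢ)`. Summing over `v = e₁, …, e_ℓ` and
inserting the curvature bounds gives `κ ∑ μᵢ ≤ K` and `κ ∑ μᵢ² ≤ K ∑ μᵢ`; the arithmetic-geometric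
mean inequality, respectively the Cauchy-Schwarz inequality, finishes the proof.
-/

noncomputable section

namespace HermitianGeometry

open Asymptotics Filter Topology Matrix
open scoped ComplexConjugate

section Jets

/-- The ring `ℂ[t, t̄] / (t², t̄²)` of the second order jets at `0 : ℂ` in which only the mixed
second order term is recorded; `t` and `t̄` are the dual units of the inner and the outer layer. -/
abbrev MixedJet : Type := DualNumber (DualNumber ℂ)

/-- The jet `a + b t + b' t̄ + d t t̄`. -/
def mixedJet (a b b' d : ℂ) : MixedJet :=
  TrivSqZeroExt.inl (TrivSqZeroExt.inl a + TrivSqZeroExt.inr b)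
    + TrivSqZeroExt.inr (TrivSqZeroExt.inl b' + TrivSqZeroExt.inr d)

theorem mixedJet_eta (J : MixedJet) : mixedJet J.fst.fst J.fst.snd J.snd.fst J.snd.snd = J := by
  ext <;> simp [mixedJet]

theorem mixedJet_add (a₁ b₁ b₁' d₁ a₂ b₂ b₂' d₂ : ℂ) :
    mixedJet a₁ b₁ b₁' d₁ + mixedJet a₂ b₂ b₂' d₂
      = mixedJet (a₁ + a₂) (b₁ + b₂) (b₁' + b₂') (d₁ + d₂) := by
  ext <;> simp [mixedJet]

theorem mixedJet_sub (a₁ b₁ b₁' d₁ a₂ b₂ b₂' d₂ : ℂ) :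
    mixedJet a₁ b₁ b₁' d₁ - mixedJet a₂ b₂ b₂' d₂
      = mixedJet (a₁ - a₂) (b₁ - b₂) (b₁' - b₂') (d₁ - d₂) := by
  ext <;> simp [mixedJet]

theorem mixedJet_mul (a₁ b₁ b₁' d₁ a₂ b₂ b₂' d₂ : ℂ) :
    mixedJet a₁ b₁ b₁' d₁ * mixedJet a₂ b₂ b₂' d₂
      = mixedJet (a₁ * a₂) (a₁ * b₂ + b₁ * a₂) (a₁ * b₂' + b₁' * a₂)
        (a₁ * d₂ + b₁ * b₂' + b₁' * b₂ + d₁ * a₂) := by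
  ext <;> (simp [mixedJet]; try ring)

theorem mixedJet_sum {ι : Type*} (s : Finset ι) (a b b' d : ι → ℂ) :
    ∑ i ∈ s, mixedJet (a i) (b i) (b' i) (d i)
      = mixedJet (∑ i ∈ s, a i) (∑ i ∈ s, b i) (∑ i ∈ s, b' i) (∑ i ∈ s, d i) := by
  classical
  induction s using Finset.induction_on with
  | empty => ext <;> simp [mixedJet]
  | insert i s hi ih => simp only [Finset.sum_insert hi, ih, mixedJet_add]

/-- The polynomial function `a + b t + b' t̄ + d t t̄` of a jet. -/
def MixedJet.eval (J : MixedJet) (t : ℂ) : ℂ :=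
  J.fst.fst + J.fst.snd * t + J.snd.fst * conj t + J.snd.snd * (t * conj t)

theorem eval_mixedJet (a b b' d t : ℂ) :
    (mixedJet a b b' d).eval t = a + b * t + b' * conj t + d * (t * conj t) := by
  simp [MixedJet.eval, mixedJet]

theorem MixedJet.tendsto_eval (J : MixedJet) : Tendsto J.eval (𝓝 0) (𝓝 J.fst.fst) := by
  have h : Continuous J.eval := by unfold eval; fun_prop
  simpa [eval] using h.tendsto 0

/-- `u` has the jet `J` at `0 : ℂ`, that is, `u t = J(t) + c t² + e t̄² + o(|t|²)` for some
`c` and `e`. -/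
def HasJet (u : ℂ → ℂ) (J : MixedJet) : Prop :=
  ∃ c e : ℂ, (fun t => u t - (J.eval t + c * t ^ 2 + e * conj t ^ 2)) =o[𝓝 0] fun t : ℂ => t ^ 2

namespace HasJet

variable {u u₁ u₂ : ℂ → ℂ} {J J₁ J₂ : MixedJet} {a b b' d : ℂ}

theorem congr' (hu : HasJet u J) (h : u =ᶠ[𝓝 0] u₁) : HasJet u₁ J := by
  obtain ⟨c, e, hc⟩ := hu
  exact ⟨c, e, hc.congr' (h.mono fun t ht => by simp only [ht]) .rfl⟩

theorem eval (J : MixedJet) : HasJet J.eval J :=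
  ⟨0, 0, by simp⟩

theorem of_isLittleO (h : u =o[𝓝 0] fun t : ℂ => t ^ 2) : HasJet u 0 :=
  ⟨0, 0, h.congr_left fun t => by simp [MixedJet.eval]⟩

theorem const (a : ℂ) : HasJet (fun _ => a) (mixedJet a 0 0 0) :=
  ⟨0, 0, by simp [eval_mixedJet]⟩

theorem intCast (k : ℤ) : HasJet (fun _ => k) k := by
  have h : mixedJet k 0 0 0 = k := by ext <;> simp [mixedJet]
  exact h ▸ const (k : ℂ)

theorem add (h₁ : HasJet u₁ J₁) (h₂ : HasJet u₂ J₂) :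
    HasJet (fun t => u₁ t + u₂ t) (J₁ + J₂) := by
  obtain ⟨c₁, e₁, h₁⟩ := h₁
  obtain ⟨c₂, e₂, h₂⟩ := h₂
  refine ⟨c₁ + c₂, e₁ + e₂, (h₁.add h₂).congr_left fun t => ?_⟩
  simp only [MixedJet.eval, TrivSqZeroExt.fst_add, TrivSqZeroExt.snd_add]
  ring

theorem conjugate (h : HasJet u (mixedJet a b b' d)) :
    HasJet (fun t => conj (u t)) (mixedJet (conj a) (conj b') (conj b) (conj d)) := by
  obtain ⟨c, e, h⟩ := h
  refine ⟨conj e, conj c, IsLittleO.of_norm_left (h.norm_left.congr_left fun t => ?_)⟩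
  rw [← Complex.norm_conj]
  congr 1
  simp only [eval_mixedJet, map_sub, map_add, map_mul, map_pow, Complex.conj_conj]
  ring

theorem tendsto (h : HasJet u J) : Tendsto u (𝓝 0) (𝓝 J.fst.fst) := by
  obtain ⟨c, e, h⟩ := h
  have hquad : Tendsto (fun t : ℂ => t ^ 2) (𝓝 0) (𝓝 0) ∧
      Tendsto (fun t : ℂ => c * t ^ 2 + e * conj t ^ 2) (𝓝 0) (𝓝 0) := by
    constructor <;> exact Continuous.tendsto' (by fun_prop) _ _ (by simp)
  simpa [add_assoc] using
    (h.trans_tendsto hquad.1).add (J.tendsto_eval.add hquad.2)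

theorem sq_mul {φ : ℂ → ℂ} {k : ℂ} (hφ : Tendsto φ (𝓝 0) (𝓝 k)) :
    HasJet (fun t => t ^ 2 * φ t) 0 := by
  have h0 : (fun t => φ t - k) =o[𝓝 0] fun _ => (1 : ℂ) := by
    rw [isLittleO_one_iff]
    simpa using hφ.sub_const k
  refine ⟨k, 0, (((isBigO_refl (fun t : ℂ => t ^ 2) _).mul_isLittleO h0).congr_left
    fun t => ?_).congr_right fun t => mul_one _⟩
  simp only [MixedJet.eval, TrivSqZeroExt.fst_zero, TrivSqZeroExt.snd_zero]
  ring

theorem conj_sq_mul {φ : ℂ → ℂ} {k : ℂ} (hφ : Tendsto φ (𝓝 0) (𝓝 k)) :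
    HasJet (fun t => starRingEnd ℂ t ^ 2 * φ t) 0 := by
  have h := sq_mul ((Complex.continuous_conj.tendsto k).comp hφ)
  rw [← mixedJet_eta 0] at h ⊢
  simpa using HasJet.conjugate h

theorem eval_mul_eval (J₁ J₂ : MixedJet) :
    HasJet (fun t => J₁.eval t * J₂.eval t) (J₁ * J₂) := by
  obtain ⟨a₁, b₁, b₁', d₁, rfl⟩ : ∃ a b b' d, mixedJet a b b' d = J₁ := ⟨_, _, _, _, mixedJet_eta _⟩
  obtain ⟨a₂, b₂, b₂', d₂, rfl⟩ : ∃ a b b' d, mixedJet a b b' d = J₂ := ⟨_, _, _, _, mixedJet_eta _⟩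
  have hsq : HasJet (fun t => t ^ 2 * (b₁ * b₂ + (b₁ * d₂ + d₁ * b₂) * conj t
      + d₁ * d₂ * conj t ^ 2)) 0 := sq_mul (Continuous.tendsto (by fun_prop) 0)
  have hconj : HasJet (fun t => conj t ^ 2 * (b₁' * b₂' + (b₁' * d₂ + d₁ * b₂') * t)) 0 :=
    conj_sq_mul (Continuous.tendsto (by fun_prop) 0)
  have h := ((eval (mixedJet a₁ b₁ b₁' d₁ * mixedJet a₂ b₂ b₂' d₂)).add hsq).add hconj
  rw [add_zero, add_zero] at h
  refine h.congr' (.of_forall fun t => ?_)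
  simp only [mixedJet_mul, eval_mixedJet]
  ring

theorem mul (h₁ : HasJet u₁ J₁) (h₂ : HasJet u₂ J₂) :
    HasJet (fun t => u₁ t * u₂ t) (J₁ * J₂) := by
  have hu₂ := h₂.tendsto
  obtain ⟨c₁, e₁, h₁⟩ := h₁
  obtain ⟨c₂, e₂, h₂⟩ := h₂
  have hJ₁ := J₁.tendsto_eval
  set r₁ := fun t => u₁ t - (J₁.eval t + c₁ * t ^ 2 + e₁ * conj t ^ 2) with hr₁
  set r₂ := fun t => u₂ t - (J₂.eval t + c₂ * t ^ 2 + e₂ * conj t ^ 2) with hr₂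
  have hrem : (fun t => r₁ t * u₂ t + J₁.eval t * r₂ t) =o[𝓝 0] fun t : ℂ => t ^ 2 := by
    simpa using (h₁.mul_isBigO (hu₂.isBigO_one ℂ)).add
      (((hJ₁.isBigO_one ℂ).mul_isLittleO h₂).congr_right fun t => mul_comm _ _)
  have hpoly : HasJet (fun t => J₁.eval t * J₂.eval t) (J₁ * J₂) :=
    eval_mul_eval J₁ J₂
  have hsq : HasJet (fun t => t ^ 2 * (c₁ * u₂ t + c₂ * J₁.eval t)) 0 :=
    sq_mul ((hu₂.const_mul c₁).add (hJ₁.const_mul c₂))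
  have hconj : HasJet (fun t => conj t ^ 2 * (e₁ * u₂ t + e₂ * J₁.eval t)) 0 :=
    conj_sq_mul ((hu₂.const_mul e₁).add (hJ₁.const_mul e₂))
  have h := ((hpoly.add hsq).add hconj).add (of_isLittleO hrem)
  simp only [add_zero] at h
  convert h using 2 with t
  simp only [hr₁, hr₂]
  ring

theorem congr_jet (hu : HasJet u J) (h : J = J₁) : HasJet u J₁ := h ▸ hu

theorem const_mul (k : ℂ) (h : HasJet u J) :
    HasJet (fun t => k * u t) (mixedJet k 0 0 0 * J) := (const k).mul h

theorem sub (h₁ : HasJet u₁ J₁) (h₂ : HasJet u₂ J₂) :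
    HasJet (fun t => u₁ t - u₂ t) (J₁ - J₂) := by
  simpa only [Int.cast_neg, Int.cast_one, neg_one_mul, ← sub_eq_add_neg] using
    h₁.add ((intCast (-1)).mul h₂)

theorem sum {ι : Type*} (s : Finset ι) {u : ι → ℂ → ℂ} {J : ι → MixedJet}
    (h : ∀ i ∈ s, HasJet (u i) (J i)) : HasJet (fun t => ∑ i ∈ s, u i t) (∑ i ∈ s, J i) := by
  classical
  induction s using Finset.induction_on with
  | empty => exact of_isLittleO (by simp)
  | insert i s hi ih =>
    simp only [Finset.sum_insert hi]
    exact (h i (Finset.mem_insert_self _ _)).add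
      (ih fun j hj => h j (Finset.mem_insert_of_mem hj))

theorem prod {ι : Type*} (s : Finset ι) {u : ι → ℂ → ℂ} {J : ι → MixedJet}
    (h : ∀ i ∈ s, HasJet (u i) (J i)) : HasJet (fun t => ∏ i ∈ s, u i t) (∏ i ∈ s, J i) := by
  classical
  induction s using Finset.induction_on with
  | empty => simpa using intCast 1
  | insert i s hi ih =>
    simp only [Finset.prod_insert hi]
    exact (h i (Finset.mem_insert_self _ _)).mul
      (ih fun j hj => h j (Finset.mem_insert_of_mem hj))

theorem det {ι : Type*} [Fintype ι] [DecidableEq ι] {X : ℂ → Matrix ι ι ℂ} {J : Matrix ι ι MixedJet}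
    (h : ∀ i j, HasJet (fun t => X t i j) (J i j)) : HasJet (fun t => (X t).det) J.det := by
  simp only [Matrix.det_apply']
  exact sum _ fun σ _ => (intCast _).mul (prod _ fun i _ => h (σ i) i)

theorem of_analyticAt (h : AnalyticAt ℂ u 0) : HasJet u (mixedJet (u 0) (deriv u 0) 0 0) := by
  obtain ⟨p, hp⟩ := h
  have hcubic : (fun t : ℂ => ‖t‖ ^ 3) =o[𝓝 0] fun t : ℂ => t ^ 2 := by
    simpa using (isLittleO_pow_pow (𝕜 := ℂ) (show 2 < 3 by norm_num)).norm_left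
  have hp₀ : p.coeff 0 = u 0 := hp.coeff_zero _
  have hp₁ : p.coeff 1 = deriv u 0 := hp.deriv.symm
  refine ⟨p.coeff 2, 0, ((hp.isBigO_sub_partialSum_pow 3).trans_isLittleO hcubic).congr_left
    fun t => ?_⟩
  simp only [FormalMultilinearSeries.partialSum, Finset.sum_range_succ, Finset.sum_range_zero,
    FormalMultilinearSeries.apply_eq_prod_smul_coeff, Fin.prod_const, smul_eq_mul, hp₀, hp₁,
    eval_mixedJet, zero_add]
  ring

/-- Averaging over the fourth roots of unity removes every term but the mixed one. -/
theorem isLittleO_average (h : HasJet u (mixedJet a b b' d)) :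
    (fun t => u t + u (-t) + u (Complex.I * t) + u (-(Complex.I * t))
      - (4 * a + 4 * d * (t * conj t))) =o[𝓝 0] fun t : ℂ => t ^ 2 := by
  obtain ⟨c, e, h⟩ := h
  have hrot (k : ℂ) : (fun t => u (k * t) - ((mixedJet a b b' d).eval (k * t) + c * (k * t) ^ 2
      + e * conj (k * t) ^ 2)) =o[𝓝 0] fun t : ℂ => t ^ 2 := by
    refine (h.comp_tendsto (Continuous.tendsto' (f := fun t => k * t) (by fun_prop) 0 0
      (by simp))).trans_isBigO ?_
    simpa [Function.comp_def, mul_pow] using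
      (isBigO_refl (fun t : ℂ => t ^ 2) (𝓝 0)).const_mul_left (k ^ 2)
  refine ((((hrot 1).add (hrot (-1))).add (hrot Complex.I)).add (hrot (-Complex.I))).congr_left
    fun t => ?_
  simp only [eval_mixedJet, map_mul, map_neg, Complex.conj_I, one_mul, neg_mul]
  linear_combination
    (2 * d * (t * conj t) - 2 * c * t ^ 2 - 2 * e * conj t ^ 2) * Complex.I_sq

theorem re_nonpos_of_isLocalMax (h : HasJet u (mixedJet a b b' d))
    (hmax : ∀ᶠ t in 𝓝 0, (u t).re ≤ a.re) : d.re ≤ 0 := by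
  by_contra! hd
  have hrot (k : ℂ) : ∀ᶠ t in 𝓝 0, (u (k * t)).re ≤ a.re :=
    (Continuous.tendsto' (f := fun t => k * t) (by fun_prop) 0 0 (by simp)).eventually hmax
  have hne : ∃ᶠ t : ℂ in 𝓝 0, t ≠ 0 := frequently_iff_neBot.2 (inferInstanceAs (𝓝[≠] 0).NeBot)
  obtain ⟨t, ht, hbound, h₁, h₂, h₃, h₄⟩ := (hne.and_eventually
    ((h.isLittleO_average.bound hd).and ((hrot 1).and ((hrot (-1)).and
      ((hrot Complex.I).and (hrot (-Complex.I))))))).exists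
  have hlow := (abs_le.1 ((Complex.abs_re_le_norm _).trans hbound)).1
  have hpos : 0 < d.re * ‖t‖ ^ 2 := by positivity
  simp only [Complex.mul_conj, Complex.normSq_eq_norm_sq, norm_pow, Complex.sub_re,
    Complex.add_re, Complex.re_mul_ofReal] at hlow
  simp only [Complex.mul_re, Complex.re_ofNat, Complex.im_ofNat, zero_mul, sub_zero] at hlow
  simp only [one_mul, neg_mul] at h₁ h₂ h₃ h₄
  linarith

end HasJet

end Jets

section Determinant

variable {ι : Type*} [Fintype ι] [DecidableEq ι]

theorem det_one_add_smul_of_sq_eq_zero {R : Type*} [CommRing R] {r : R} (hr : r ^ 2 = 0)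
    (A : Matrix ι ι R) : (1 + r • A).det = 1 + r * A.trace := by
  rw [det_one_add_smul, hr, mul_zero, add_zero, mul_comm]

theorem det_one_add_smul_add_smul {R : Type*} [CommRing R] {r s : R} (hr : r ^ 2 = 0)
    (hs : s ^ 2 = 0) (B B' D : Matrix ι ι R) :
    (1 + r • B + s • B' + (r * s) • D).det
      = 1 + r * B.trace + s * B'.trace
        + r * s * (D.trace + B.trace * B'.trace - (B * B').trace) := by
  have hfactor : 1 + r • B + s • B' + (r * s) • D
      = (1 + r • B) * (1 + s • B') * (1 + (r * s) • (D - B * B')) := by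
    have hB : (r • B) * ((r * s) • (D - B * B')) = 0 := by
      rw [smul_mul_smul_comm, ← mul_assoc, ← sq, hr, zero_mul, zero_smul]
    have hB' : (s • B') * ((r * s) • (D - B * B')) = 0 := by
      rw [smul_mul_smul_comm, mul_left_comm, ← sq, hs, mul_zero, zero_smul]
    have hright : (1 + s • B') * (1 + (r * s) • (D - B * B'))
        = 1 + s • B' + (r * s) • (D - B * B') := by
      rw [mul_add, mul_one, add_mul, one_mul, hB', add_zero]
    rw [mul_assoc, hright, add_mul, one_mul, mul_add (r • B), hB, mul_add, mul_one,
      smul_mul_smul_comm, smul_sub]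
    abel
  have hrs : (r * s) ^ 2 = 0 := by rw [mul_pow, hr, zero_mul]
  rw [hfactor, det_mul, det_mul, det_one_add_smul_of_sq_eq_zero hr,
    det_one_add_smul_of_sq_eq_zero hs, det_one_add_smul_of_sq_eq_zero hrs, trace_sub]
  linear_combination
    (B.trace * s * (1 + s * B'.trace) * (D.trace - (B * B').trace)) * hr
      + (r * B'.trace * (D.trace - (B * B').trace)) * hs

theorem det_mixedJet (B B' D : Matrix ι ι ℂ) :
    (of fun i j => mixedJet ((1 : Matrix ι ι ℂ) i j) (B i j) (B' i j) (D i j)).det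
      = mixedJet 1 B.trace B'.trace (D.trace + B.trace * B'.trace - (B * B').trace) := by
  set τ := mixedJet 0 1 0 0
  set τ' := mixedJet 0 0 1 0
  have hτ : τ ^ 2 = 0 := by ext <;> simp [τ, mixedJet, sq]
  have hτ' : τ' ^ 2 = 0 := by ext <;> simp [τ', mixedJet, sq]
  have halg (a : ℂ) : algebraMap ℂ MixedJet a = mixedJet a 0 0 0 := by
    ext <;> simp [mixedJet] <;> rfl
  have hexpand (a b b' d : ℂ) : mixedJet a b b' d = algebraMap ℂ MixedJet a
      + τ * algebraMap ℂ MixedJet b + τ' * algebraMap ℂ MixedJet b'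
      + τ * τ' * algebraMap ℂ MixedJet d := by
    simp only [halg]
    ext <;> simp [τ, τ', mixedJet]
  have hmatrix : (of fun i j => mixedJet ((1 : Matrix ι ι ℂ) i j) (B i j) (B' i j) (D i j))
      = 1 + τ • B.map (algebraMap ℂ MixedJet) + τ' • B'.map (algebraMap ℂ MixedJet)
        + (τ * τ') • D.map (algebraMap ℂ MixedJet) := by
    rw [← Matrix.map_one (algebraMap ℂ MixedJet) (map_zero _) (map_one _)]
    ext1 i j
    exact hexpand _ _ _ _
  have htrace (A : Matrix ι ι ℂ) :
      (A.map (algebraMap ℂ MixedJet)).trace = algebraMap ℂ MixedJet A.trace :=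
    (AddMonoidHom.map_trace (algebraMap ℂ MixedJet).toAddMonoidHom A).symm
  rw [hmatrix, det_one_add_smul_add_smul hτ hτ', ← Matrix.map_mul, hexpand]
  simp only [htrace, map_add, map_sub, map_mul, map_one]

end Determinant

section Wirtinger

theorem taylor_two_isLittleO {E F : Type*} [NormedAddCommGroup E] [NormedSpace ℝ E]
    [NormedAddCommGroup F] [NormedSpace ℝ F] {G : E → F} {x : E} (hG : ContDiffAt ℝ 2 G x) :
    (fun y => G y - (G x + fderiv ℝ G x (y - x)
      + (1 / 2 : ℝ) • fderiv ℝ (fderiv ℝ G) x (y - x) (y - x))) =o[𝓝 x]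
      fun y => ‖y - x‖ ^ 2 := by
  have hdiff : ∀ᶠ y in 𝓝 x, DifferentiableAt ℝ G y :=
    (hG.eventually (by simp)).mono fun y hy => hy.differentiableAt (by simp)
  obtain ⟨r, hr, hball⟩ := Metric.eventually_nhds_iff_ball.1 hdiff
  have hdiff' : DifferentiableAt ℝ (fderiv ℝ G) x :=
    (hG.fderiv_right (m := 1) (by norm_num)).differentiableAt (by simp)
  have hsymm : IsSymmSndFDerivAt ℝ G x := hG.isSymmSndFDerivAt (by simp)
  set B := fderiv ℝ (fderiv ℝ G) x
  have hderiv : ∀ y ∈ Metric.ball x r, HasFDerivWithinAt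
      (fun y => G y - (G x + fderiv ℝ G x (y - x) + (1 / 2 : ℝ) • B (y - x) (y - x)))
      (fderiv ℝ G y - fderiv ℝ G x - B (y - x)) (Metric.ball x r) y := by
    intro y hy
    have hsub : HasFDerivAt (fun y => y - x) (ContinuousLinearMap.id ℝ E) y :=
      (hasFDerivAt_id y).sub_const x
    have hlin := (fderiv ℝ G x).hasFDerivAt (x := y - x) |>.comp y hsub
    have hquad := ((B.hasFDerivAt (x := y - x)).comp y hsub).clm_apply hsub
    refine (((hball y hy).hasFDerivAt.sub ((hlin.const_add (G x)).add
      (hquad.const_smul (1 / 2 : ℝ)))).congr_fderiv ?_).hasFDerivWithinAt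
    ext w
    have hpolar : (1 / 2 : ℝ) • (B (y - x) w + B w (y - x)) = B (y - x) w := by
      rw [show B w (y - x) = B (y - x) w from hsymm w (y - x), ← two_smul ℝ, smul_smul]
      norm_num
    change fderiv ℝ G y w - (fderiv ℝ G x w + (1 / 2 : ℝ) • (B (y - x) w + B w (y - x)))
      = fderiv ℝ G y w - fderiv ℝ G x w - B (y - x) w
    rw [hpolar, sub_sub]
  have hnhds : 𝓝[Metric.ball x r] x = 𝓝 x := nhdsWithin_eq_nhds.2 (Metric.ball_mem_nhds x hr)
  have h := (convex_ball x r).isLittleO_pow_succ (n := 1) (Metric.mem_ball_self hr) hderiv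
    (by simpa only [pow_one, hnhds] using hdiff'.hasFDerivAt.isLittleO.norm_right)
  simpa [hnhds] using h

variable {m : ℕ}

/-- The coefficient of `zⁱ` of a real-linear form on `ℂᵐ`. -/
def coeffDz (i : Fin m) : (Cn m →L[ℝ] ℂ) →L[ℝ] ℂ :=
  (1 / 2 : ℂ) • (ContinuousLinearMap.apply ℝ ℂ (EuclideanSpace.single i (1 : ℂ) : Cn m)
    - Complex.I • ContinuousLinearMap.apply ℝ ℂ (EuclideanSpace.single i Complex.I : Cn m))

/-- The coefficient of `z̄ⁱ` of a real-linear form on `ℂᵐ`. -/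
def coeffDzbar (i : Fin m) : (Cn m →L[ℝ] ℂ) →L[ℝ] ℂ :=
  (1 / 2 : ℂ) • (ContinuousLinearMap.apply ℝ ℂ (EuclideanSpace.single i (1 : ℂ) : Cn m)
    + Complex.I • ContinuousLinearMap.apply ℝ ℂ (EuclideanSpace.single i Complex.I : Cn m))

theorem dz_eq_coeffDz (i : Fin m) (G : Cn m → ℂ) (z : Cn m) :
    dz i G z = coeffDz i (fderiv ℝ G z) := by
  simp [dz, coeffDz]

theorem dzbar_eq_coeffDzbar (i : Fin m) (G : Cn m → ℂ) (z : Cn m) :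
    dzbar i G z = coeffDzbar i (fderiv ℝ G z) := by
  simp [dzbar, coeffDzbar, mul_add]

theorem apply_eq_sum_coeff (A : Cn m →L[ℝ] ℂ) (v : Cn m) :
    A v = ∑ i, (coeffDz i A * v i + coeffDzbar i A * conj (v i)) := by
  have hv : v = ∑ i, ((v i).re • (EuclideanSpace.single i (1 : ℂ) : Cn m)
      + (v i).im • (EuclideanSpace.single i Complex.I : Cn m)) := by
    ext j
    simp [Finset.sum_add_distrib, Pi.single_apply]
  conv_lhs => rw [hv]
  rw [map_sum]
  refine Finset.sum_congr rfl fun i _ => ?_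
  simp only [map_add, map_smul, coeffDz, coeffDzbar, _root_.smul_apply, _root_.sub_apply,
    _root_.add_apply, ContinuousLinearMap.apply_apply, smul_eq_mul, Complex.real_smul]
  have hre : (v i).re + (v i).im * Complex.I = v i := Complex.re_add_im _
  have hconj : conj (v i) = (v i).re - (v i).im * Complex.I := by
    apply Complex.ext <;> simp
  rw [hconj]
  nth_rewrite 3 [← hre]
  linear_combination ((v i).im * A (EuclideanSpace.single i Complex.I) : ℂ) * Complex.I_sq

theorem dz_conj {G : Cn m → ℂ} {z : Cn m} (hG : DifferentiableAt ℝ G z) (i : Fin m) :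
    dz i (fun w => conj (G w)) z = conj (dzbar i G z) := by
  have h : fderiv ℝ (fun w => conj (G w)) z = (Complex.conjCLE : ℂ →L[ℝ] ℂ).comp (fderiv ℝ G z) :=
    ((Complex.conjCLE : ℂ →L[ℝ] ℂ).hasFDerivAt.comp z hG.hasFDerivAt).fderiv
  rw [dz, dzbar, h]
  simp only [map_mul, map_add, Complex.conj_I, map_div₀, map_one, map_ofNat]
  simp [sub_eq_add_neg]

theorem dz_dzbar_eq_coeff {G : Cn m → ℂ} {z : Cn m} (hG : ContDiffAt ℝ 2 G z) (i j : Fin m) :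
    dz i (dzbar j G) z = coeffDz i ((coeffDzbar j).comp (fderiv ℝ (fderiv ℝ G) z)) := by
  have hG' : DifferentiableAt ℝ (fderiv ℝ G) z :=
    (hG.fderiv_right (m := 1) (by norm_num)).differentiableAt (by simp)
  rw [dz_eq_coeffDz, funext (dzbar_eq_coeffDzbar j G)]
  exact congrArg _ ((coeffDzbar j).hasFDerivAt.comp z hG'.hasFDerivAt).fderiv

theorem coeffDz_coeffDzbar_comm {B : Cn m →L[ℝ] Cn m →L[ℝ] ℂ} (hB : ∀ v w, B v w = B w v)
    (i j : Fin m) :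
    coeffDz i ((coeffDzbar j).comp B) = coeffDzbar j ((coeffDz i).comp B) := by
  simp only [coeffDz, coeffDzbar, _root_.smul_apply, ContinuousLinearMap.comp_apply,
    _root_.sub_apply, _root_.add_apply, ContinuousLinearMap.apply_apply, smul_eq_mul]
  simp only [hB (EuclideanSpace.single j _)]
  ring

theorem hasJet_apply_of_analyticAt {ι : Type*} {X : ℂ → EuclideanSpace ℂ ι} [Fintype ι]
    (hX : AnalyticAt ℂ X 0) (i : ι) :
    HasJet (fun t => X t i) (mixedJet (X 0 i) (deriv X 0 i) 0 0) := by
  have hderiv : HasDerivAt (fun t => X t i) (deriv X 0 i) 0 :=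
    ((EuclideanSpace.proj i : EuclideanSpace ℂ ι →L[ℂ] ℂ).hasFDerivAt).comp_hasDerivAt 0
      hX.differentiableAt.hasDerivAt
  simpa only [hderiv.deriv] using HasJet.of_analyticAt (u := fun t => X t i)
    (((EuclideanSpace.proj i : EuclideanSpace ℂ ι →L[ℂ] ℂ).analyticAt _).comp hX)

theorem hasJet_clm_comp {X : ℂ → Cn m} (hX : AnalyticAt ℂ X 0) (A : Cn m →L[ℝ] ℂ) :
    HasJet (fun t => A (X t)) (mixedJet (A (X 0)) (∑ i, coeffDz i A * deriv X 0 i)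
      (∑ i, coeffDzbar i A * conj (deriv X 0 i)) 0) := by
  simp only [apply_eq_sum_coeff A]
  refine (HasJet.sum Finset.univ fun i _ =>
    ((hasJet_apply_of_analyticAt hX i).const_mul (coeffDz i A)).add
      ((hasJet_apply_of_analyticAt hX i).conjugate.const_mul (coeffDzbar i A))).congr_jet ?_
  simp [mixedJet_mul, mixedJet_add, mixedJet_sum]

theorem hasJet_sndDeriv_comp {G : Cn m → ℂ} {z : Cn m} (hG : ContDiffAt ℝ 2 G z)
    {X : ℂ → Cn m} (hX : AnalyticAt ℂ X 0) (hX₀ : X 0 = 0) :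
    HasJet (fun t => fderiv ℝ (fderiv ℝ G) z (X t) (X t))
      (mixedJet 0 0 0 (2 * ∑ i, ∑ j,
        dz i (dzbar j G) z * deriv X 0 i * conj (deriv X 0 j))) := by
  set B := fderiv ℝ (fderiv ℝ G) z
  have hsymm : ∀ x y, B x y = B y x := fun x y => hG.isSymmSndFDerivAt (by simp) x y
  have hcoord : ∀ x, B x x = ∑ i, ((coeffDz i).comp B x * x i
      + (coeffDzbar i).comp B x * conj (x i)) := fun x => apply_eq_sum_coeff (B x) x
  simp only [hcoord]
  refine (HasJet.sum Finset.univ fun i _ =>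
    ((hasJet_clm_comp hX ((coeffDz i).comp B)).mul (hasJet_apply_of_analyticAt hX i)).add
      ((hasJet_clm_comp hX ((coeffDzbar i).comp B)).mul
        (hasJet_apply_of_analyticAt hX i).conjugate)).congr_jet ?_
  have hmixed (i j : Fin m) : dz i (dzbar j G) z = coeffDzbar j ((coeffDz i).comp B) := by
    rw [dz_dzbar_eq_coeff hG, coeffDz_coeffDzbar_comm hsymm]
  simp only [hX₀, map_zero, PiLp.zero_apply, mixedJet_mul, mixedJet_add, mixedJet_sum, mul_zero,
    zero_mul, add_zero, zero_add, Finset.sum_const_zero, Finset.sum_add_distrib, Finset.sum_mul]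
  congr 1
  rw [two_mul]
  congr 1
  · exact Finset.sum_congr rfl fun i _ => Finset.sum_congr rfl fun j _ => by rw [hmixed]; ring
  · rw [Finset.sum_comm]
    exact Finset.sum_congr rfl fun i _ => Finset.sum_congr rfl fun j _ => by
      rw [dz_dzbar_eq_coeff hG]

theorem hasJet_comp_of_analyticAt {G : Cn m → ℂ} {γ : ℂ → Cn m} (hG : ContDiffAt ℝ 2 G (γ 0))
    (hγ : AnalyticAt ℂ γ 0) :
    HasJet (fun t => G (γ t)) (mixedJet (G (γ 0)) (∑ i, dz i G (γ 0) * deriv γ 0 i)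
      (∑ i, dzbar i G (γ 0) * conj (deriv γ 0 i))
      (∑ i, ∑ j, dz i (dzbar j G) (γ 0) * deriv γ 0 i * conj (deriv γ 0 j))) := by
  set X := fun t => γ t - γ 0 with hX
  have hXγ : AnalyticAt ℂ X 0 := hγ.sub analyticAt_const
  have hX₀ : X 0 = 0 := sub_self _
  have hderiv : deriv X 0 = deriv γ 0 := by simp [hX]
  have hbigO : (fun t => ‖X t‖ ^ 2) =O[𝓝 0] fun t : ℂ => t ^ 2 := by
    have h := hXγ.differentiableAt.isBigO_sub
    simp only [hX₀, sub_zero] at h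
    exact h.norm_left.pow 2
  have hrem := ((taylor_two_isLittleO hG).comp_tendsto hγ.continuousAt).trans_isBigO hbigO
  have h := (((HasJet.const (G (γ 0))).add (hasJet_clm_comp hXγ (fderiv ℝ G (γ 0)))).add
    ((hasJet_sndDeriv_comp hG hXγ hX₀).const_mul (1 / 2))).add (HasJet.of_isLittleO hrem)
  refine (h.congr' (.of_forall fun t => by simp [hX, Complex.real_smul])).congr_jet ?_
  simp only [hderiv, hX₀, dz_eq_coeffDz, dzbar_eq_coeffDzbar, mixedJet_mul, mixedJet_add,
    map_zero, add_zero, mul_zero, zero_add, one_div]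
  simp

end Wirtinger

section Curvature

variable {m : ℕ}

/-- The sesquilinear form `∑ cᵢ c̄'ⱼ Aᵢⱼ` of a matrix. -/
def sesqForm (A : Matrix (Fin m) (Fin m) ℂ) (c c' : Cn m) : ℂ :=
  c.ofLp ⬝ᵥ (A *ᵥ star c'.ofLp)

theorem sesqForm_eq_sum (A : Matrix (Fin m) (Fin m) ℂ) (c c' : Cn m) :
    sesqForm A c c' = ∑ i, ∑ j, c i * conj (c' j) * A i j := by
  simp only [sesqForm, dotProduct, mulVec, Finset.mul_sum, Pi.star_apply, starRingEnd_apply]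
  exact Finset.sum_congr rfl fun i _ => Finset.sum_congr rfl fun j _ => by ring

theorem sesqForm_add_left (A : Matrix (Fin m) (Fin m) ℂ) (x x' y : Cn m) :
    sesqForm A (x + x') y = sesqForm A x y + sesqForm A x' y := by
  simp [sesqForm, add_dotProduct]

theorem sesqForm_add_right (A : Matrix (Fin m) (Fin m) ℂ) (x y y' : Cn m) :
    sesqForm A x (y + y') = sesqForm A x y + sesqForm A x y' := by
  simp [sesqForm, mulVec_add, dotProduct_add]

theorem sesqForm_vecMul_left (A B : Matrix (Fin m) (Fin m) ℂ) (x y : Cn m) :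
    sesqForm A (WithLp.toLp 2 (x.ofLp ᵥ* B)) y = sesqForm (B * A) x y := by
  simp only [sesqForm]
  rw [← mulVec_mulVec, ← dotProduct_mulVec]

theorem sesqForm_vecMul_right (A B : Matrix (Fin m) (Fin m) ℂ) (x y : Cn m) :
    sesqForm A x (WithLp.toLp 2 (y.ofLp ᵥ* B)) = sesqForm (A * Bᴴ) x y := by
  simp only [sesqForm, star_vecMul, mulVec_mulVec]

variable (A : Cn m → Matrix (Fin m) (Fin m) ℂ) (z v : Cn m)

/-- The derivative `∂_v A` of type `(1, 0)`. -/
def dzMatrix : Matrix (Fin m) (Fin m) ℂ :=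
  of fun k l => ∑ i, dz i (fun w => A w k l) z * v i

/-- The derivative `∂̄_v A` of type `(0, 1)`. -/
def dzbarMatrix : Matrix (Fin m) (Fin m) ℂ :=
  of fun k l => ∑ i, dzbar i (fun w => A w k l) z * conj (v i)

/-- The Levi form of `A` in direction `v`. -/
def leviMatrix : Matrix (Fin m) (Fin m) ℂ :=
  of fun k l => ∑ i, ∑ j, dz i (dzbar j fun w => A w k l) z * v i * conj (v j)

/-- The form `R(v, v̄, ·, ·)` of the Chern curvature of a Hermitian metric with matrix `A`. -/
def curvMatrix : Matrix (Fin m) (Fin m) ℂ :=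
  -leviMatrix A z v + dzMatrix A z v * (A z)⁻¹ * dzbarMatrix A z v

/-- The form in direction `v` of the Chern connection of a Hermitian metric with matrix `A`; it
acts on row vectors. -/
def connMatrix : Matrix (Fin m) (Fin m) ℂ :=
  dzMatrix A z v * (A z)⁻¹

/-- The covariant derivative at `0` of a holomorphic vector field `X` along a holomorphic disc `γ`,
for the Chern connection of a Hermitian metric with matrix `A`. -/
def covDeriv (γ X : ℂ → Cn m) : Cn m :=
  deriv X 0 + WithLp.toLp 2 ((X 0).ofLp ᵥ* connMatrix A (γ 0) (deriv γ 0))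

variable {A z v} {γ X Y : ℂ → Cn m}

theorem dzMatrix_conjTranspose (hA : ∀ k l, DifferentiableAt ℝ (fun w => A w k l) z)
    (hherm : ∀ᶠ w in 𝓝 z, (A w).IsHermitian) : (dzMatrix A z v)ᴴ = dzbarMatrix A z v := by
  ext k l
  have h (i : Fin m) : dz i (fun w => A w l k) z = conj (dzbar i (fun w => A w k l) z) := by
    have hconj : (fun w => A w l k) =ᶠ[𝓝 z] fun w => conj (A w k l) :=
      hherm.mono fun w hw => (hw.apply l k).symm
    rw [← dz_conj (hA k l), dz, dz, hconj.fderiv_eq]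
  simp [dzMatrix, dzbarMatrix, h]

theorem connMatrix_mul (hunit : IsUnit (A z).det) :
    connMatrix A z v * A z = dzMatrix A z v := by
  rw [connMatrix, Matrix.mul_assoc, nonsing_inv_mul _ hunit, Matrix.mul_one]

theorem mul_connMatrix_conjTranspose (hA : ∀ k l, DifferentiableAt ℝ (fun w => A w k l) z)
    (hherm : ∀ᶠ w in 𝓝 z, (A w).IsHermitian) (hunit : IsUnit (A z).det) :
    A z * (connMatrix A z v)ᴴ = dzbarMatrix A z v := by
  rw [← dzMatrix_conjTranspose hA hherm, ← connMatrix_mul hunit, conjTranspose_mul,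
    hherm.self_of_nhds]

theorem curvMatrix_eq_connMatrix (hA : ∀ k l, DifferentiableAt ℝ (fun w => A w k l) z)
    (hherm : ∀ᶠ w in 𝓝 z, (A w).IsHermitian) :
    curvMatrix A z v = -leviMatrix A z v + dzMatrix A z v * (connMatrix A z v)ᴴ := by
  rw [curvMatrix, connMatrix, conjTranspose_mul, conjTranspose_nonsing_inv, hherm.self_of_nhds,
    dzMatrix_conjTranspose hA hherm, Matrix.mul_assoc]

theorem hasJet_matrix_comp (hγ : AnalyticAt ℂ γ 0) {k l : Fin m}
    (hA : ContDiffAt ℝ 2 (fun w => A w k l) (γ 0)) :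
    HasJet (fun t => A (γ t) k l) (mixedJet (A (γ 0) k l) (dzMatrix A (γ 0) (deriv γ 0) k l)
      (dzbarMatrix A (γ 0) (deriv γ 0) k l) (leviMatrix A (γ 0) (deriv γ 0) k l)) :=
  hasJet_comp_of_analyticAt hA hγ

/-- The covariant derivatives complete the square in the product rule; the curvature is what
remains. -/
theorem hasJet_sesqForm_comp (hγ : AnalyticAt ℂ γ 0) (hX : AnalyticAt ℂ X 0)
    (hY : AnalyticAt ℂ Y 0) (hA : ∀ k l, ContDiffAt ℝ 2 (fun w => A w k l) (γ 0))
    (hherm : ∀ᶠ w in 𝓝 (γ 0), (A w).IsHermitian) (hunit : IsUnit (A (γ 0)).det) :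
    HasJet (fun t => sesqForm (A (γ t)) (X t) (Y t))
      (mixedJet (sesqForm (A (γ 0)) (X 0) (Y 0)) (sesqForm (A (γ 0)) (covDeriv A γ X) (Y 0))
        (sesqForm (A (γ 0)) (X 0) (covDeriv A γ Y))
        (sesqForm (A (γ 0)) (covDeriv A γ X) (covDeriv A γ Y)
          - sesqForm (curvMatrix A (γ 0) (deriv γ 0)) (X 0) (Y 0))) := by
  have hA' (k l : Fin m) := (hA k l).differentiableAt (by simp)
  have h := HasJet.sum Finset.univ fun i _ => HasJet.sum Finset.univ fun j _ =>
    ((hasJet_apply_of_analyticAt hX i).mul (hasJet_apply_of_analyticAt hY j).conjugate).mul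
      (hasJet_matrix_comp hγ (hA i j))
  simp only [sesqForm_eq_sum (A _) (X _) (Y _)]
  refine h.congr_jet ?_
  simp only [mixedJet_mul, mixedJet_sum]
  congr 1
  · rw [covDeriv, sesqForm_add_left, sesqForm_vecMul_left, connMatrix_mul hunit]
    simp only [sesqForm_eq_sum, ← Finset.sum_add_distrib]
    refine Finset.sum_congr rfl fun i _ => Finset.sum_congr rfl fun j _ => ?_
    rw [map_zero]
    ring
  · rw [covDeriv, sesqForm_add_right, sesqForm_vecMul_right,
      mul_connMatrix_conjTranspose hA' hherm hunit]
    simp only [sesqForm_eq_sum, ← Finset.sum_add_distrib]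
    refine Finset.sum_congr rfl fun i _ => Finset.sum_congr rfl fun j _ => ?_
    ring
  · rw [covDeriv, covDeriv, curvMatrix_eq_connMatrix hA' hherm, sesqForm_add_left,
      sesqForm_add_right, sesqForm_add_right, sesqForm_vecMul_left, sesqForm_vecMul_right,
      sesqForm_vecMul_left, connMatrix_mul hunit, mul_connMatrix_conjTranspose hA' hherm hunit,
      sesqForm_vecMul_right]
    simp only [sesqForm_eq_sum, ← Finset.sum_add_distrib, ← Finset.sum_sub_distrib]
    refine Finset.sum_congr rfl fun i _ => Finset.sum_congr rfl fun j _ => ?_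
    rw [map_zero, Matrix.add_apply, Matrix.neg_apply]
    ring

end Curvature

section InnerProduct

variable {𝕜 E F : Type*} [RCLike 𝕜] [NormedAddCommGroup E] [InnerProductSpace 𝕜 E]
  [FiniteDimensional 𝕜 E] [NormedAddCommGroup F] [InnerProductSpace 𝕜 F] {l : ℕ}

theorem exists_orthonormal_eq_sum_smul (hl : l ≤ Module.finrank 𝕜 E) (v : Fin l → E) :
    ∃ u : Fin l → E, Orthonormal 𝕜 u ∧ ∃ C : Matrix (Fin l) (Fin l) 𝕜,
      ∀ i, v i = ∑ a, C i a • u a := by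
  set f : Fin (Module.finrank 𝕜 E) → E := fun i => if h : (i : ℕ) < l then v ⟨i, h⟩ else 0
  have hcard : Module.finrank 𝕜 E = Fintype.card (Fin (Module.finrank 𝕜 E)) := by simp
  let b := InnerProductSpace.gramSchmidtOrthonormalBasis hcard f
  have hinj : Function.Injective (Fin.castLE hl) := Fin.castLE_injective hl
  refine ⟨fun a => b (Fin.castLE hl a), b.orthonormal.comp _ hinj,
    of fun i a => inner 𝕜 (b (Fin.castLE hl a)) (v i), fun i => ?_⟩
  have hf : f (Fin.castLE hl i) = v i := by simp [f]
  conv_lhs => rw [← b.sum_repr (v i)]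
  simp only [b.repr_apply_apply, of_apply]
  refine (Finset.sum_of_injOn (Fin.castLE hl) hinj.injOn (by simp) (fun j _ hj => ?_)
    fun _ _ => rfl).symm
  have hlt : Fin.castLE hl i < j := by
    by_contra! hji
    exact hj ⟨⟨j, (Fin.le_def.1 hji).trans_lt i.isLt⟩, by simp, rfl⟩
  rw [← hf, InnerProductSpace.gramSchmidtOrthonormalBasis_inv_triangular hcard f hlt, zero_smul]

theorem exists_orthonormal_of_orthogonal {ι : Type*} [Fintype ι] [LinearOrder ι]
    [LocallyFiniteOrderBot ι] [WellFoundedLT ι] (hcard : Module.finrank 𝕜 E = Fintype.card ι)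
    (v : ι → E) (hv : Pairwise fun i j => inner 𝕜 (v i) (v j) = 0) :
    ∃ b : ι → E, Orthonormal 𝕜 b ∧ ∀ i, v i = (‖v i‖ : 𝕜) • b i := by
  refine ⟨_, (InnerProductSpace.gramSchmidtOrthonormalBasis hcard v).orthonormal, fun i => ?_⟩
  by_cases hi : v i = 0
  · simp [hi]
  · have hnorm : (‖v i‖ : 𝕜) ≠ 0 := by simpa using hi
    simp [InnerProductSpace.gramSchmidtOrthonormalBasis_apply_of_orthogonal hcard hv hi,
      smul_smul, hnorm]

theorem exists_orthonormal_sum_singularValues [FiniteDimensional 𝕜 F]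
    (hl : l ≤ Module.finrank 𝕜 E) (L : E →ₗ[𝕜] F) :
    ∃ u : Fin l → E, Orthonormal 𝕜 u ∧
      ∑ a ∈ Finset.range l, L.singularValues a ^ 2 = ∑ i, ‖L (u i)‖ ^ 2 := by
  have hsymm := L.isSymmetric_adjoint_comp_self
  let b := hsymm.eigenvectorBasis rfl
  refine ⟨fun a => b (Fin.castLE hl a), b.orthonormal.comp _ (Fin.castLE_injective hl), ?_⟩
  rw [← Fin.sum_univ_eq_sum_range (fun a => L.singularValues a ^ 2)]
  refine Finset.sum_congr rfl fun i _ => ?_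
  have heigen := hsymm.apply_eigenvectorBasis rfl (Fin.castLE hl i)
  have hnorm : (inner 𝕜 (b (Fin.castLE hl i)) (b (Fin.castLE hl i)) : 𝕜) = 1 := by simp
  rw [← Fin.val_castLE hl i, L.sq_singularValues_fin rfl, ← inner_self_eq_norm_sq (𝕜 := 𝕜),
    ← LinearMap.adjoint_inner_right, ← LinearMap.comp_apply, heigen, inner_smul_right, hnorm,
    mul_one, RCLike.ofReal_re]

end InnerProduct

theorem exists_orthonormal_sum_singularValuesOf {V W : Type*} [AddCommGroup V] [Module ℂ V]
    [FiniteDimensional ℂ V] [AddCommGroup W] [Module ℂ W] [FiniteDimensional ℂ W]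
    (cV : InnerProductSpace.Core ℂ V) (cW : InnerProductSpace.Core ℂ W) {l : ℕ}
    (hl : l ≤ Module.finrank ℂ V) (L : V →ₗ[ℂ] W) :
    ∃ u : Fin l → V, (∀ i j, cV.inner (u i) (u j) = if i = j then 1 else 0) ∧
      ∑ a ∈ Finset.range l, singularValuesOf cV cW L a ^ 2
        = ∑ i, (cW.inner (L (u i)) (L (u i))).re := by
  let _ : NormedAddCommGroup V := cV.toNormedAddCommGroup
  let _ : InnerProductSpace ℂ V := InnerProductSpace.ofCore cV.toCore
  let _ : NormedAddCommGroup W := cW.toNormedAddCommGroup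
  let _ : InnerProductSpace ℂ W := InnerProductSpace.ofCore cW.toCore
  obtain ⟨u, hu, hsum⟩ := exists_orthonormal_sum_singularValues hl L
  simp only [← inner_self_eq_norm_sq (𝕜 := ℂ)] at hsum
  exact ⟨u, orthonormal_iff_ite.1 hu, hsum⟩

section Tangent

variable {m n : ℕ} {M N : Type*} [TopologicalSpace M] [ChartedSpace (Cn m) M]
  [TopologicalSpace N] [ChartedSpace (Cn n) N]

theorem finrank_tangent (x : M) : Module.finrank ℂ (T m x) = m :=
  finrank_euclideanSpace_fin

instance finiteDimensional_tangent (x : M) : FiniteDimensional ℂ (T m x) :=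
  inferInstanceAs (FiniteDimensional ℂ (Cn m))

namespace HermitianMetric

variable (g : HermitianMetric m M) {x : M} {l : ℕ} {e : Fin l → T m x}

theorem re_inner_self_nonneg (v : T m x) : 0 ≤ (g.inner x v v).re :=
  (g.core x).re_inner_nonneg v

variable {g} in
theorem isUnitary_iff_orthonormal :
    letI : NormedAddCommGroup (T m x) := (g.core x).toNormedAddCommGroup
    letI : InnerProductSpace ℂ (T m x) := InnerProductSpace.ofCore (g.core x).toCore
    g.IsUnitary x e ↔ Orthonormal ℂ e := by
  let _ : NormedAddCommGroup (T m x) := (g.core x).toNormedAddCommGroup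
  let _ : InnerProductSpace ℂ (T m x) := InnerProductSpace.ofCore (g.core x).toCore
  rw [orthonormal_iff_ite, forall_comm]
  refine forall₂_congr fun i j => ?_
  simp only [eq_comm (a := i)]
  rfl

theorem exists_isUnitary_eq_sum_smul (hl : l ≤ m) (v : Fin l → T m x) :
    ∃ u : Fin l → T m x, g.IsUnitary x u ∧ ∃ C : Matrix (Fin l) (Fin l) ℂ,
      ∀ i, v i = ∑ a, C i a • u a := by
  let _ : NormedAddCommGroup (T m x) := (g.core x).toNormedAddCommGroup
  let _ : InnerProductSpace ℂ (T m x) := InnerProductSpace.ofCore (g.core x).toCore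
  obtain ⟨u, hu, hspan⟩ := exists_orthonormal_eq_sum_smul (𝕜 := ℂ)
    (hl.trans_eq (finrank_tangent x).symm) v
  exact ⟨u, isUnitary_iff_orthonormal.2 hu, hspan⟩

theorem exists_isUnitary_of_orthogonal (v : Fin m → T m x)
    (hv : Pairwise fun i j => g.inner x (v i) (v j) = 0) :
    ∃ b : Fin m → T m x, g.IsUnitary x b ∧
      ∀ i, v i = (√(g.inner x (v i) (v i)).re : ℂ) • b i := by
  let _ : NormedAddCommGroup (T m x) := (g.core x).toNormedAddCommGroup
  let _ : InnerProductSpace ℂ (T m x) := InnerProductSpace.ofCore (g.core x).toCore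
  obtain ⟨b, hb, hvb⟩ := exists_orthonormal_of_orthogonal (𝕜 := ℂ)
    (by rw [Fintype.card_fin]; exact finrank_tangent x) v fun i j hij => hv hij.symm
  exact ⟨b, isUnitary_iff_orthonormal.2 hb, hvb⟩

theorem card_le_of_orthogonal {ι : Type*} [Fintype ι] {v : ι → T m x} (hv : ∀ i, v i ≠ 0)
    (horth : Pairwise fun i j => g.inner x (v i) (v j) = 0) : Fintype.card ι ≤ m := by
  let _ : NormedAddCommGroup (T m x) := (g.core x).toNormedAddCommGroup
  let _ : InnerProductSpace ℂ (T m x) := InnerProductSpace.ofCore (g.core x).toCore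
  have hindep : LinearIndependent ℂ v :=
    linearIndependent_of_ne_zero_of_inner_eq_zero hv fun i j hij => horth hij.symm
  exact hindep.fintype_card_le_finrank.trans_eq (finrank_tangent x)

variable {g}

theorem IsUnitary.sum_normSq_inner_le (he : g.IsUnitary x e) (v : T m x) :
    ∑ j, Complex.normSq (g.inner x v (e j)) ≤ (g.inner x v v).re := by
  let _ : NormedAddCommGroup (T m x) := (g.core x).toNormedAddCommGroup
  let _ : InnerProductSpace ℂ (T m x) := InnerProductSpace.ofCore (g.core x).toCore
  have h := (isUnitary_iff_orthonormal.1 he).sum_inner_products_le (x := v) (s := Finset.univ)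
  rw [← inner_self_eq_norm_sq (𝕜 := ℂ)] at h
  simp only [Complex.normSq_eq_norm_sq]
  exact h

theorem IsUnitary.isUnitaryBasis_span (he : g.IsUnitary x e) :
    Module.finrank ℂ (Submodule.span ℂ (Set.range e)) = l ∧
      g.IsUnitaryBasis x (Submodule.span ℂ (Set.range e)) e := by
  let _ : NormedAddCommGroup (T m x) := (g.core x).toNormedAddCommGroup
  let _ : InnerProductSpace ℂ (T m x) := InnerProductSpace.ofCore (g.core x).toCore
  refine ⟨?_, he, rfl⟩
  rw [finrank_span_eq_card (isUnitary_iff_orthonormal.1 he).linearIndependent, Fintype.card_fin]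

end HermitianMetric

theorem exists_isUnitary_sigma_eq (g : HermitianMetric m M) (h : HermitianMetric n N) (f : M → N)
    {l : ℕ} (hl : l ≤ m) (x : M) :
    ∃ u : Fin l → T m x, g.IsUnitary x u ∧
      sigma g h f l x = ∑ i, (h.inner (f x) (tmap f x (u i)) (tmap f x (u i))).re := by
  obtain ⟨u, hu, hsum⟩ := exists_orthonormal_sum_singularValuesOf (g.core x) (h.core (f x))
    (hl.trans_eq (finrank_tangent x).symm) (tmap f x)
  exact ⟨u, fun i j => (hu j i).trans (by simp only [eq_comm]), hsum⟩

end Tangent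

section Gram

variable {V ι : Type*} [AddCommGroup V] [Module ℂ V]

/-- The Gram matrix `(B (vᵢ, vⱼ))` of a family of vectors with respect to a sesquilinear form. -/
def gram (B : V →ₗ[ℂ] V →ₗ⋆[ℂ] ℂ) (v : ι → V) : Matrix ι ι ℂ :=
  of fun i j => B (v i) (v j)

variable {B G : V →ₗ[ℂ] V →ₗ⋆[ℂ] ℂ} {u v : ι → V}

theorem gram_isHermitian (hB : ∀ u v, conj (B v u) = B u v) (v : ι → V) :
    (gram B v).IsHermitian := by
  ext i j
  exact hB _ _

variable [Fintype ι]

theorem gram_sum_smul (B : V →ₗ[ℂ] V →ₗ⋆[ℂ] ℂ) (C : Matrix ι ι ℂ) (u : ι → V) :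
    gram B (fun i => ∑ a, C i a • u a) = C * gram B u * Cᴴ := by
  ext i j
  simp only [gram, of_apply, map_sum, map_smul, LinearMap.sum_apply, LinearMap.smul_apply,
    map_smulₛₗ, smul_eq_mul, mul_apply, conjTranspose_apply, Finset.sum_mul]
  refine Finset.sum_congr rfl fun a _ => ?_
  rw [Finset.mul_sum]
  refine Finset.sum_congr rfl fun b _ => ?_
  rw [starRingEnd_apply]
  ring

theorem trace_gram_re_nonneg (hB : ∀ v, 0 ≤ (B v v).re) (v : ι → V) :
    0 ≤ (gram B v).trace.re := by
  rw [trace, Complex.re_sum]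
  exact Finset.sum_nonneg fun i _ => hB _

variable [DecidableEq ι] {C : Matrix ι ι ℂ}

theorem det_gram_of_eq_sum_smul (B : V →ₗ[ℂ] V →ₗ⋆[ℂ] ℂ) (hv : ∀ i, v i = ∑ a, C i a • u a) :
    (gram B v).det = Complex.normSq C.det * (gram B u).det := by
  rw [funext hv, gram_sum_smul, det_mul, det_mul, det_conjTranspose, ← Complex.mul_conj,
    starRingEnd_apply]
  ring

theorem det_gram_re_le_mul_det_gram_re {c : ℝ} (hv : ∀ i, v i = ∑ a, C i a • u a)
    (hu : gram G u = 1) (hc : (gram B u).det.re ≤ c) :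
    (gram B v).det.re ≤ c * (gram G v).det.re := by
  rw [det_gram_of_eq_sum_smul B hv, det_gram_of_eq_sum_smul G hv, hu, det_one, mul_one,
    Complex.re_ofReal_mul, Complex.ofReal_re, mul_comm]
  gcongr
  exact Complex.normSq_nonneg _

theorem det_gram_smul (B : V →ₗ[ℂ] V →ₗ⋆[ℂ] ℂ) (c : ι → ℂ) (u : ι → V) :
    (gram B fun i => c i • u i).det = Complex.normSq (∏ i, c i) * (gram B u).det := by
  rw [← det_diagonal]
  exact det_gram_of_eq_sum_smul B fun i => by simp [diagonal_apply]

theorem det_gram_smul_re_le_det_gram_re {W : Type*} [AddCommGroup W] [Module ℂ W]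
    {B₀ : W →ₗ[ℂ] W →ₗ⋆[ℂ] ℂ} {c : ι → ℂ} {w : ι → W} (hv : ∀ i, v i = ∑ a, C i a • u a)
    (hu : gram G u = 1) (hw : (gram B₀ fun i => c i • w i) = 1)
    (hle : (gram B u).det.re ≤ (gram B₀ w).det.re) :
    (gram B fun i => c i • v i).det.re ≤ (gram G v).det.re := by
  have hone : Complex.normSq (∏ i, c i) * (gram B₀ w).det.re = 1 := by
    rw [← Complex.re_ofReal_mul, ← det_gram_smul, hw, det_one, Complex.one_re]
  rw [det_gram_smul, Complex.re_ofReal_mul]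
  calc Complex.normSq (∏ i, c i) * (gram B v).det.re
      ≤ Complex.normSq (∏ i, c i) * ((gram B₀ w).det.re * (gram G v).det.re) := by
        gcongr
        · exact Complex.normSq_nonneg _
        · exact det_gram_re_le_mul_det_gram_re hv hu hle
    _ = (gram G v).det.re := by rw [← mul_assoc, hone, one_mul]

/-- Here `2 - gram G v` is the linearization at `1` of the inverse of `gram G v`, and lies below
that inverse: with `v = C u` the difference of the two sides is the trace of the nonnegative Gram
matrix of `(1 - Cᴴ C) u`. -/
theorem trace_gram_mul_two_sub_gram_re_le (hB : ∀ v, 0 ≤ (B v v).re)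
    (hv : ∀ i, v i = ∑ a, C i a • u a) (hu : gram G u = 1) :
    (gram B v * (2 - gram G v)).trace.re ≤ (gram B u).trace.re := by
  have hdefect : (gram B fun i => ∑ a, (1 - Cᴴ * C) i a • u a).trace
      = (gram B u).trace - (gram B v * (2 - gram G v)).trace := by
    rw [funext hv, gram_sum_smul, gram_sum_smul, gram_sum_smul, hu]
    have hself : (1 - Cᴴ * C)ᴴ = 1 - Cᴴ * C := by simp
    have hcycle : (C * gram B u * Cᴴ * (2 - C * 1 * Cᴴ)).trace
        = ((2 * (Cᴴ * C) - Cᴴ * C * (Cᴴ * C)) * gram B u).trace := by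
      rw [Matrix.mul_assoc, Matrix.mul_assoc, trace_mul_comm, Matrix.mul_assoc, trace_mul_comm]
      congr 1
      noncomm_ring
    rw [hself, trace_mul_comm, ← Matrix.mul_assoc, hcycle, ← trace_sub]
    congr 1
    noncomm_ring
  have hnonneg := trace_gram_re_nonneg hB fun i => ∑ a, (1 - Cᴴ * C) i a • u a
  rw [hdefect, Complex.sub_re] at hnonneg
  linarith

theorem exists_gram_eq_diagonal (hB : ∀ u v, conj (B v u) = B u v) (hu : gram G u = 1) :
    ∃ (w : ι → V) (μ : ι → ℝ), gram G w = 1 ∧ gram B w = diagonal (fun i => (μ i : ℂ)) ∧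
      (gram B w).det = (gram B u).det ∧ (gram B w).trace = (gram B u).trace := by
  have hB' := gram_isHermitian hB u
  set U : Matrix ι ι ℂ := ↑hB'.eigenvectorUnitary
  set D : Matrix ι ι ℂ := diagonal fun i => (hB'.eigenvalues i : ℂ)
  have hUU : Uᴴ * U = 1 := Unitary.coe_star_mul_self _
  have hUU' : U * Uᴴ = 1 := Unitary.coe_mul_star_self _
  have hspec : gram B u = U * D * Uᴴ := by
    conv_lhs => rw [hB'.spectral_theorem]
    rfl
  have hconj : Uᴴ * gram B u * Uᴴᴴ = D := by
    rw [hspec, conjTranspose_conjTranspose, ← Matrix.mul_assoc, ← Matrix.mul_assoc, hUU,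
      Matrix.one_mul, Matrix.mul_assoc, hUU, Matrix.mul_one]
  have hdiag : gram B (fun i => ∑ a, Uᴴ i a • u a) = D := (gram_sum_smul B Uᴴ u).trans hconj
  refine ⟨fun i => ∑ a, Uᴴ i a • u a, hB'.eigenvalues, ?_, hdiag, ?_, ?_⟩
  · rw [gram_sum_smul, hu, Matrix.mul_one, conjTranspose_conjTranspose, hUU]
  · rw [hdiag, hspec, det_mul_right_comm, hUU', Matrix.one_mul]
  · rw [hdiag, hspec, trace_mul_comm, ← Matrix.mul_assoc, hUU, Matrix.one_mul]

end Gram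

section Coordinates

variable {m : ℕ} {M : Type*} [TopologicalSpace M] [ChartedSpace (Cn m) M]
  {φ : OpenPartialHomeomorph M (Cn m)} {z : Cn m}

/-- The components of a tangent vector at `y` in the chart `φ`. -/
def coords (φ : OpenPartialHomeomorph M (Cn m)) (y : M) : T m y →ₗ[ℂ] Cn m :=
  (mfderiv 𝓘(ℂ, Cn m) 𝓘(ℂ, Cn m) φ y).toLinearMap

theorem comp_eq_coords (x : M) (u : T m x) (i : Fin m) :
    comp x u i = coords (chartAt (Cn m) x) x u i :=
  rfl

namespace HermitianMetric

variable (g : HermitianMetric m M)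

theorem matrix_isHermitian (φ : OpenPartialHomeomorph M (Cn m)) (z : Cn m) :
    (g.matrix φ z).IsHermitian := by
  ext i j
  exact g.conj_symm _ _ _

theorem contDiffAt_matrix (hφ : φ ∈ atlas (Cn m) M) (hz : z ∈ φ.target) (k l : Fin m) :
    ContDiffAt ℝ ∞ (fun w => g.matrix φ w k l) z :=
  (g.smooth φ hφ k l).contDiffAt (φ.open_target.mem_nhds hz)

end HermitianMetric

variable [IsManifold 𝓘(ℂ, Cn m) 1 M]

theorem coords_bijective (hφ : φ ∈ atlas (Cn m) M) {y : M} (hy : y ∈ φ.source) :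
    Function.Bijective (coords φ y) :=
  (mdifferentiable_of_mem_atlas (I := 𝓘(ℂ, Cn m)) hφ).mfderiv_bijective hy

theorem coords_coordVec (hφ : φ ∈ atlas (Cn m) M) (hz : z ∈ φ.target) (i : Fin m) :
    coords φ (φ.symm z) (coordVec φ z i) = EuclideanSpace.single i (1 : ℂ) :=
  congrArg (fun L => L (EuclideanSpace.single i (1 : ℂ) : Cn m))
    ((mdifferentiable_of_mem_atlas (I := 𝓘(ℂ, Cn m)) hφ).comp_symm_deriv hz)

theorem eq_sum_coords_smul_coordVec (hφ : φ ∈ atlas (Cn m) M) (hz : z ∈ φ.target)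
    (u : T m (φ.symm z)) : u = ∑ i, coords φ (φ.symm z) u i • coordVec φ z i := by
  refine (coords_bijective hφ (φ.map_target hz)).1 ?_
  simp only [map_sum, map_smul, coords_coordVec hφ hz]
  ext j
  simp [Pi.single_apply]

namespace HermitianMetric

variable (g : HermitianMetric m M)

theorem inner_eq_sesqForm (hφ : φ ∈ atlas (Cn m) M) {y : M} (hy : y ∈ φ.source) (u w : T m y) :
    g.inner y u w = sesqForm (g.matrix φ (φ y)) (coords φ y u) (coords φ y w) := by
  obtain ⟨z, hz, rfl⟩ : ∃ z ∈ φ.target, φ.symm z = y := ⟨φ y, φ.map_source hy, φ.left_inv hy⟩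
  rw [φ.right_inv hz, sesqForm_eq_sum, Finset.sum_comm]
  conv_lhs =>
    rw [eq_sum_coords_smul_coordVec hφ hz u, eq_sum_coords_smul_coordVec hφ hz w]
  simp only [map_sum, map_smul, LinearMap.sum_apply, LinearMap.smul_apply, map_smulₛₗ, smul_eq_mul,
    matrix, of_apply, Finset.mul_sum]
  refine Finset.sum_congr rfl fun j _ => Finset.sum_congr rfl fun i _ => ?_
  ring

theorem inner_symm_eq_sesqForm (hφ : φ ∈ atlas (Cn m) M) (hz : z ∈ φ.target)
    (u w : T m (φ.symm z)) :
    g.inner (φ.symm z) u w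
      = sesqForm (g.matrix φ z) (coords φ (φ.symm z) u) (coords φ (φ.symm z) w) := by
  rw [g.inner_eq_sesqForm hφ (φ.map_target hz), φ.right_inv hz]

theorem isUnit_det_matrix (hφ : φ ∈ atlas (Cn m) M) (hz : z ∈ φ.target) :
    IsUnit (g.matrix φ z).det := by
  rw [isUnit_iff_ne_zero]
  intro hdet
  obtain ⟨c, hc, hcA⟩ := exists_vecMul_eq_zero_iff.2 hdet
  have hy := φ.map_target hz
  obtain ⟨u, hu⟩ := (coords_bijective hφ hy).2 (WithLp.toLp 2 c)
  have hu0 : u ≠ 0 := by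
    rintro rfl
    rw [map_zero] at hu
    exact hc (congrArg WithLp.ofLp hu).symm
  have hpos := g.pos _ u hu0
  rw [g.inner_symm_eq_sesqForm hφ hz, hu, sesqForm, dotProduct_mulVec, hcA,
    zero_dotProduct] at hpos
  exact hpos.ne rfl

end HermitianMetric

end Coordinates

section Pullback

theorem eventually_mem_target_and_mem_source {X X' Y Y' : Type*} [TopologicalSpace X]
    [TopologicalSpace X'] [TopologicalSpace Y] [TopologicalSpace Y']
    {φ : OpenPartialHomeomorph X X'} {ψ : OpenPartialHomeomorph Y Y'} {f : X → Y} {y : X}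
    (hf : ContinuousAt f y) (hy : y ∈ φ.source) (hfy : f y ∈ ψ.source) :
    ∀ᶠ z in 𝓝 (φ y), z ∈ φ.target ∧ f (φ.symm z) ∈ ψ.source := by
  have hcont : ContinuousAt (f ∘ φ.symm) (φ y) :=
    ContinuousAt.comp (by rwa [φ.left_inv hy]) (φ.symm.continuousAt (φ.map_source hy))
  refine (φ.open_target.eventually_mem (φ.map_source hy)).and (hcont.preimage_mem_nhds ?_)
  exact ψ.open_source.mem_nhds (by rwa [Function.comp_apply, φ.left_inv hy])

variable {m n : ℕ} {M N : Type*} [TopologicalSpace M] [ChartedSpace (Cn m) M]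
  [TopologicalSpace N] [ChartedSpace (Cn n) N]

/-- The Hermitian form `f*h` on the tangent space at `x`. -/
def pullInner (h : HermitianMetric n N) (f : M → N) (x : M) : T m x →ₗ[ℂ] T m x →ₗ⋆[ℂ] ℂ :=
  LinearMap.mk₂'ₛₗ (RingHom.id ℂ) (starRingEnd ℂ)
    (fun u v => h.inner (f x) (tmap f x u) (tmap f x v)) (by simp) (by simp) (by simp) (by simp)

section

variable (h : HermitianMetric n N) (f : M → N) (x : M)

theorem pullInner_apply (u v : T m x) :
    pullInner h f x u v = h.inner (f x) (tmap f x u) (tmap f x v) :=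
  rfl

theorem pullInner_conj_symm (u v : T m x) : conj (pullInner h f x v u) = pullInner h f x u v :=
  h.conj_symm _ _ _

theorem pullInner_self_re_nonneg (u : T m x) : 0 ≤ (pullInner h f x u u).re :=
  h.re_inner_self_nonneg _

end

/-- The map `f` in the charts `φ` and `ψ`. -/
def chartExpr (φ : OpenPartialHomeomorph M (Cn m)) (ψ : OpenPartialHomeomorph N (Cn n))
    (f : M → N) (z : Cn m) : Cn n :=
  ψ (f (φ.symm z))

variable {f : M → N} {φ : OpenPartialHomeomorph M (Cn m)} {ψ : OpenPartialHomeomorph N (Cn n)}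

variable [IsManifold 𝓘(ℂ, Cn m) ω M] [IsManifold 𝓘(ℂ, Cn n) ω N]

theorem analyticAt_chartExpr (hf : ContMDiff 𝓘(ℂ, Cn m) 𝓘(ℂ, Cn n) ω f)
    (hφ : φ ∈ atlas (Cn m) M) (hψ : ψ ∈ atlas (Cn n) N) {z : Cn m} (hz : z ∈ φ.target)
    (hfz : f (φ.symm z) ∈ ψ.source) : AnalyticAt ℂ (chartExpr φ ψ f) z := by
  have hφ' : ContMDiffAt 𝓘(ℂ, Cn m) 𝓘(ℂ, Cn m) ω φ.symm z :=
    contMDiffAt_symm_of_mem_maximalAtlas (IsManifold.subset_maximalAtlas hφ) hz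
  have hψ' : ContMDiffAt 𝓘(ℂ, Cn n) 𝓘(ℂ, Cn n) ω ψ (f (φ.symm z)) :=
    contMDiffAt_of_mem_maximalAtlas (IsManifold.subset_maximalAtlas hψ) hfz
  have hcomp : ContMDiffAt 𝓘(ℂ, Cn m) 𝓘(ℂ, Cn n) ω (chartExpr φ ψ f) z :=
    hψ'.comp z ((hf _).comp z hφ')
  exact hcomp.contDiffAt.analyticAt

theorem coords_tmap (hf : ContMDiff 𝓘(ℂ, Cn m) 𝓘(ℂ, Cn n) ω f)
    (hφ : φ ∈ atlas (Cn m) M) (hψ : ψ ∈ atlas (Cn n) N) {y : M} (hy : y ∈ φ.source)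
    (hfy : f y ∈ ψ.source) (u : T m y) :
    coords ψ (f y) (tmap f y u) = fderiv ℂ (chartExpr φ ψ f) (φ y) (coords φ y u) := by
  have : IsManifold 𝓘(ℂ, Cn m) 1 M := IsManifold.of_le (n := ω) le_top
  have : IsManifold 𝓘(ℂ, Cn n) 1 N := IsManifold.of_le (n := ω) le_top
  have hF := (analyticAt_chartExpr hf hφ hψ (φ.map_source hy)
    (by rwa [φ.left_inv hy])).differentiableAt
  have hφ' := (mdifferentiable_of_mem_atlas (I := 𝓘(ℂ, Cn m)) hφ).mdifferentiableAt hy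
  have hψ' := (mdifferentiable_of_mem_atlas (I := 𝓘(ℂ, Cn n)) hψ).mdifferentiableAt hfy
  have hf' : MDifferentiableAt 𝓘(ℂ, Cn m) 𝓘(ℂ, Cn n) f y := (hf y).mdifferentiableAt (by simp)
  have hcomm : ψ ∘ f =ᶠ[𝓝 y] chartExpr φ ψ f ∘ φ := by
    filter_upwards [φ.open_source.mem_nhds hy] with y' hy'
    simp [chartExpr, φ.left_inv hy']
  have hderiv := (mfderiv_comp y hψ' hf').symm.trans
    (hcomm.mfderiv_eq.trans (mfderiv_comp y hF.mdifferentiableAt hφ'))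
  rw [mfderiv_eq_fderiv] at hderiv
  exact congrArg (fun L => L u) hderiv

theorem pullInner_symm_eq_sesqForm (h : HermitianMetric n N)
    (hf : ContMDiff 𝓘(ℂ, Cn m) 𝓘(ℂ, Cn n) ω f) (hφ : φ ∈ atlas (Cn m) M) (hψ : ψ ∈ atlas (Cn n) N)
    {z : Cn m} (hz : z ∈ φ.target) (hfz : f (φ.symm z) ∈ ψ.source) (u w : T m (φ.symm z)) :
    pullInner h f (φ.symm z) u w = sesqForm (h.matrix ψ (chartExpr φ ψ f z))
      (fderiv ℂ (chartExpr φ ψ f) z (coords φ (φ.symm z) u))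
      (fderiv ℂ (chartExpr φ ψ f) z (coords φ (φ.symm z) w)) := by
  have : IsManifold 𝓘(ℂ, Cn n) 1 N := IsManifold.of_le (n := ω) le_top
  have hy := φ.map_target hz
  rw [pullInner_apply, h.inner_eq_sesqForm hψ hfz, coords_tmap hf hφ hψ hy hfz,
    coords_tmap hf hφ hψ hy hfz, φ.right_inv hz]
  rfl

end Pullback

section Chern

variable {m : ℕ} {M : Type*} [TopologicalSpace M] [ChartedSpace (Cn m) M]

theorem sum_sum_comm_sum_sum {α ι κ μ ν : Type*} [AddCommMonoid α] [Fintype ι] [Fintype κ]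
    [Fintype μ] [Fintype ν] (F : ι → κ → μ → ν → α) :
    ∑ i, ∑ j, ∑ k, ∑ l, F i j k l = ∑ k, ∑ l, ∑ i, ∑ j, F i j k l := by
  rw [Finset.sum_congr rfl fun i _ => Finset.sum_comm, Finset.sum_comm]
  refine Finset.sum_congr rfl fun k _ => ?_
  rw [Finset.sum_congr rfl fun i _ => Finset.sum_comm, Finset.sum_comm]

namespace HermitianMetric

variable (g : HermitianMetric m M)

theorem curvMatrix_apply (φ : OpenPartialHomeomorph M (Cn m)) (z v : Cn m) (k l : Fin m) :
    curvMatrix (g.matrix φ) z v k l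
      = ∑ i, ∑ j, g.chernComp φ z i j k l * v i * conj (v j) := by
  have hquadratic :
      (dzMatrix (g.matrix φ) z v * (g.matrix φ z)⁻¹ * dzbarMatrix (g.matrix φ) z v) k l
      = ∑ i, ∑ j, (∑ p, ∑ q, g.inv φ z p q * dz i (fun w => g.matrix φ w k q) z
        * dzbar j (fun w => g.matrix φ w p l) z) * v i * conj (v j) := by
    simp only [Matrix.mul_apply, dzMatrix, dzbarMatrix, of_apply, Finset.sum_mul, Finset.mul_sum,
      inv]
    conv_rhs => rw [sum_sum_comm_sum_sum]
    refine Finset.sum_congr rfl fun p _ => ?_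
    rw [Finset.sum_comm]
    refine Finset.sum_congr rfl fun q _ => ?_
    rw [Finset.sum_comm]
    refine Finset.sum_congr rfl fun i _ => Finset.sum_congr rfl fun j _ => ?_
    ring
  rw [curvMatrix, Matrix.add_apply, hquadratic, Matrix.neg_apply, leviMatrix, of_apply]
  simp only [chernComp, add_mul, Finset.sum_add_distrib, neg_mul, Finset.sum_neg_distrib]

theorem chern_eq_sesqForm (x : M) (v u w : T m x) :
    g.chern x v v u w = sesqForm
      (curvMatrix (g.matrix (chartAt (Cn m) x)) (chartAt (Cn m) x x)
        (coords (chartAt (Cn m) x) x v))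
      (coords (chartAt (Cn m) x) x u) (coords (chartAt (Cn m) x) x w) := by
  simp only [sesqForm_eq_sum, curvMatrix_apply, chern, comp_eq_coords, Finset.mul_sum]
  rw [sum_sum_comm_sum_sum]
  refine Finset.sum_congr rfl fun k _ => Finset.sum_congr rfl fun l _ =>
    Finset.sum_congr rfl fun i _ => Finset.sum_congr rfl fun j _ => ?_
  ring

theorem chern_smul (x : M) (a b c d : ℂ) (u v w y : T m x) :
    g.chern x (a • u) (b • v) (c • w) (d • y) = a * conj b * c * conj d * g.chern x u v w y := by
  simp only [chern, comp_eq_coords, map_smul, PiLp.smul_apply, smul_eq_mul, map_mul,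
    Finset.mul_sum]
  refine Finset.sum_congr rfl fun i _ => Finset.sum_congr rfl fun j _ =>
    Finset.sum_congr rfl fun k _ => Finset.sum_congr rfl fun l _ => ?_
  ring

variable {g} [IsManifold 𝓘(ℂ, Cn m) 1 M] {x : M} {u : Fin m → T m x}

theorem IsUnitary.inv_eq_sum (hu : g.IsUnitary x u) (i j : Fin m) :
    g.inv (chartAt (Cn m) x) (chartAt (Cn m) x x) i j
      = ∑ a, comp x (u a) i * conj (comp x (u a) j) := by
  set A := g.matrix (chartAt (Cn m) x) (chartAt (Cn m) x x) with hA
  let E : Matrix (Fin m) (Fin m) ℂ := of fun a i => comp x (u a) i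
  have hunitary : E * (A * Eᴴ) = 1 := by
    ext a b
    rw [one_apply, ← hu a b, g.inner_eq_sesqForm (chart_mem_atlas _ x) (mem_chart_source _ x)]
    rfl
  have hinv : A * (Eᴴ * E) = 1 := by rw [← Matrix.mul_assoc]; exact mul_eq_one_comm.1 hunitary
  rw [inv, ← hA, inv_eq_right_inv hinv, Matrix.mul_apply]
  exact Finset.sum_congr rfl fun a _ => mul_comm _ _

theorem IsUnitary.chernScalar_eq_lScalar (hu : g.IsUnitary x u) :
    g.chernScalar x = g.lScalar x u := by
  simp only [chernScalar, lScalar, ← Complex.re_sum, chern]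
  congr 1
  conv_rhs => rw [sum_sum_comm_sum_sum]
  refine Finset.sum_congr rfl fun i _ => Finset.sum_congr rfl fun j _ => ?_
  conv_rhs => rw [sum_sum_comm_sum_sum]
  refine Finset.sum_congr rfl fun k _ => Finset.sum_congr rfl fun l _ => ?_
  rw [hu.inv_eq_sum, hu.inv_eq_sum]
  simp only [Finset.sum_mul, Finset.mul_sum]
  rw [Finset.sum_comm]
  refine Finset.sum_congr rfl fun a _ => Finset.sum_congr rfl fun b _ => ?_
  ring

end HermitianMetric

end Chern

section FieldsAlongDiscs

theorem deriv_const_add_smul_const {𝕜 E : Type*} [NontriviallyNormedField 𝕜]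
    [NormedAddCommGroup E] [NormedSpace 𝕜 E] (a b : E) (t : 𝕜) :
    deriv (fun t : 𝕜 => a + t • b) t = b := by
  simpa only [id_eq, one_smul] using (((hasDerivAt_id t).smul_const b).const_add a).deriv

variable {m n : ℕ} {M N : Type*} [TopologicalSpace M] [ChartedSpace (Cn m) M]
  [TopologicalSpace N] [ChartedSpace (Cn n) N]

/-- `γ` is, in the preferred chart at `x`, a germ at `0` of a holomorphic disc through `x` with
velocity `v`. -/
structure IsDisc (x : M) (v : T m x) (γ : ℂ → Cn m) : Prop where
  analyticAt : AnalyticAt ℂ γ 0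
  apply_zero : γ 0 = chartAt (Cn m) x x
  deriv_zero : deriv γ 0 = coords (chartAt (Cn m) x) x v

/-- `X` is, in the preferred chart at `x`, a germ at `0` of a holomorphic vector field along the
disc `γ` through `x`, with value `u` and covariant derivative `s` at `x`. -/
structure HermitianMetric.IsFieldAlong (g : HermitianMetric m M) (x : M) (γ X : ℂ → Cn m)
    (u s : T m x) : Prop where
  analyticAt : AnalyticAt ℂ X 0
  apply_zero : X 0 = coords (chartAt (Cn m) x) x u
  covDeriv_eq : covDeriv (g.matrix (chartAt (Cn m) x)) γ X = coords (chartAt (Cn m) x) x s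

variable {x : M} {v : T m x} {γ X Y : ℂ → Cn m} {u s u' s' : T m x}

theorem exists_isDisc (x : M) (v : T m x) : ∃ γ, IsDisc x v γ := by
  refine ⟨fun t => chartAt (Cn m) x x + t • coords (chartAt (Cn m) x) x v, by fun_prop, by simp,
    deriv_const_add_smul_const _ _ _⟩

theorem HermitianMetric.exists_isFieldAlong_parallel (g : HermitianMetric m M) (γ : ℂ → Cn m)
    (u : T m x) : ∃ X, g.IsFieldAlong x γ X u 0 := by
  set c := coords (chartAt (Cn m) x) x u
  set d : Cn m := WithLp.toLp 2
    (c.ofLp ᵥ* connMatrix (g.matrix (chartAt (Cn m) x)) (γ 0) (deriv γ 0))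
  refine ⟨fun t => c + t • -d, by fun_prop, by simp [c], ?_⟩
  rw [covDeriv, deriv_const_add_smul_const, map_zero, zero_smul, add_zero]
  exact neg_add_cancel _

theorem HermitianMetric.hasJet_inner [IsManifold 𝓘(ℂ, Cn m) 1 M] (g : HermitianMetric m M)
    (hγ : IsDisc x v γ) (hX : g.IsFieldAlong x γ X u s) (hY : g.IsFieldAlong x γ Y u' s') :
    HasJet (fun t => sesqForm (g.matrix (chartAt (Cn m) x) (γ t)) (X t) (Y t))
      (mixedJet (g.inner x u u') (g.inner x s u') (g.inner x u s')
        (g.inner x s s' - g.chern x v v u u')) := by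
  have hφ := chart_mem_atlas (Cn m) x
  have hx := mem_chart_source (Cn m) x
  have hz : γ 0 ∈ (chartAt (Cn m) x).target := by
    rw [hγ.apply_zero]
    exact mem_chart_target (Cn m) x
  have hjet := hasJet_sesqForm_comp hγ.analyticAt hX.analyticAt hY.analyticAt
    (fun k l => (g.contDiffAt_matrix hφ hz k l).of_le ENat.LEInfty.out)
    (Eventually.of_forall (g.matrix_isHermitian _)) (g.isUnit_det_matrix hφ hz)
  rw [hX.covDeriv_eq, hY.covDeriv_eq, hX.apply_zero, hY.apply_zero, hγ.deriv_zero,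
    hγ.apply_zero] at hjet
  simp only [g.inner_eq_sesqForm hφ hx, g.chern_eq_sesqForm]
  exact hjet

variable [IsManifold 𝓘(ℂ, Cn m) ω M] [IsManifold 𝓘(ℂ, Cn n) ω N] {f : M → N}

theorem analyticAt_chartExpr_chartAt (hf : ContMDiff 𝓘(ℂ, Cn m) 𝓘(ℂ, Cn n) ω f) (x : M) :
    AnalyticAt ℂ (chartExpr (chartAt (Cn m) x) (chartAt (Cn n) (f x)) f)
      (chartAt (Cn m) x x) := by
  refine analyticAt_chartExpr hf (chart_mem_atlas _ _) (chart_mem_atlas _ _)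
    (mem_chart_target _ _) ?_
  rw [(chartAt (Cn m) x).left_inv (mem_chart_source _ _)]
  exact mem_chart_source _ _

theorem IsDisc.map (hγ : IsDisc x v γ) (hf : ContMDiff 𝓘(ℂ, Cn m) 𝓘(ℂ, Cn n) ω f) :
    IsDisc (f x) (tmap f x v)
      (fun t => chartExpr (chartAt (Cn m) x) (chartAt (Cn n) (f x)) f (γ t)) := by
  have hF := hγ.apply_zero ▸ analyticAt_chartExpr_chartAt hf x
  refine ⟨hF.fun_comp hγ.analyticAt, ?_, ?_⟩
  · rw [chartExpr, hγ.apply_zero, (chartAt (Cn m) x).left_inv (mem_chart_source _ _)]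
  · rw [coords_tmap hf (chart_mem_atlas _ _) (chart_mem_atlas _ _) (mem_chart_source _ _)
      (mem_chart_source _ _), ← hγ.deriv_zero, ← hγ.apply_zero]
    exact (hF.differentiableAt.hasFDerivAt.comp_hasDerivAt 0
      hγ.analyticAt.differentiableAt.hasDerivAt).deriv

theorem HermitianMetric.IsFieldAlong.map {g : HermitianMetric m M} (hγ : IsDisc x v γ)
    (hX : g.IsFieldAlong x γ X u s) (h : HermitianMetric n N)
    (hf : ContMDiff 𝓘(ℂ, Cn m) 𝓘(ℂ, Cn n) ω f) :
    ∃ s' : T n (f x), h.IsFieldAlong (f x)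
      (fun t => chartExpr (chartAt (Cn m) x) (chartAt (Cn n) (f x)) f (γ t))
      (fun t => fderiv ℂ (chartExpr (chartAt (Cn m) x) (chartAt (Cn n) (f x)) f) (γ t) (X t))
      (tmap f x u) s' := by
  have : IsManifold 𝓘(ℂ, Cn n) 1 N := IsManifold.of_le (n := ω) le_top
  have hF := hγ.apply_zero ▸ analyticAt_chartExpr_chartAt hf x
  obtain ⟨s', hs'⟩ := (coords_bijective (chart_mem_atlas (Cn n) (f x))
    (mem_chart_source _ (f x))).2 (covDeriv (h.matrix _) _ _)
  refine ⟨s', ?_, ?_, hs'.symm⟩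
  · exact ((ContinuousLinearMap.id ℂ (Cn m →L[ℂ] Cn n)).analyticAt_bilinear _).comp₂
      (hF.fderiv.fun_comp hγ.analyticAt) hX.analyticAt
  · rw [coords_tmap hf (chart_mem_atlas _ _) (chart_mem_atlas _ _) (mem_chart_source _ _)
      (mem_chart_source _ _), hγ.apply_zero, hX.apply_zero]

/-- The vectors `sᵢ` are the values of the second fundamental form of `f` on `(v, eᵢ)`; they appear
because `∂f` maps the parallel extension of `eᵢ` to a field with covariant derivative `sᵢ`. -/
theorem exists_gram_jets (g : HermitianMetric m M) (h : HermitianMetric n N)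
    (hf : ContMDiff 𝓘(ℂ, Cn m) 𝓘(ℂ, Cn n) ω f) {ι : Type*} (e : ι → T m x) (v : T m x) :
    ∃ (G H : ℂ → Matrix ι ι ℂ) (s : ι → T n (f x)),
      (∀ᶠ t in 𝓝 0, ∃ (y : M) (V : ι → T m y),
        G t = gram (g.inner y) V ∧ H t = gram (pullInner h f y) V) ∧
      (∀ i j, HasJet (fun t => G t i j)
        (mixedJet (g.inner x (e i) (e j)) 0 0 (-g.chern x v v (e i) (e j)))) ∧
      ∀ i j, HasJet (fun t => H t i j)
        (mixedJet (pullInner h f x (e i) (e j)) (h.inner (f x) (s i) (tmap f x (e j)))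
          (h.inner (f x) (tmap f x (e i)) (s j)) (h.inner (f x) (s i) (s j)
            - h.chern (f x) (tmap f x v) (tmap f x v) (tmap f x (e i)) (tmap f x (e j)))) := by
  have : IsManifold 𝓘(ℂ, Cn m) 1 M := IsManifold.of_le (n := ω) le_top
  have : IsManifold 𝓘(ℂ, Cn n) 1 N := IsManifold.of_le (n := ω) le_top
  set φ := chartAt (Cn m) x
  set ψ := chartAt (Cn n) (f x)
  have hφ : φ ∈ atlas (Cn m) M := chart_mem_atlas _ _
  have hψ : ψ ∈ atlas (Cn n) N := chart_mem_atlas _ _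
  obtain ⟨γ, hγ⟩ := exists_isDisc x v
  choose X hX using fun i => g.exists_isFieldAlong_parallel γ (e i)
  choose s hs using fun i => (hX i).map hγ h hf
  refine ⟨fun t => of fun i j => sesqForm (g.matrix φ (γ t)) (X i t) (X j t),
    fun t => of fun i j => sesqForm (h.matrix ψ (chartExpr φ ψ f (γ t)))
      (fderiv ℂ (chartExpr φ ψ f) (γ t) (X i t)) (fderiv ℂ (chartExpr φ ψ f) (γ t) (X j t)),
    s, ?_, fun i j => ?_, fun i j => h.hasJet_inner (hγ.map hf) (hs i) (hs j)⟩
  · have hdom := hγ.analyticAt.continuousAt.eventually (hγ.apply_zero ▸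
      eventually_mem_target_and_mem_source hf.continuous.continuousAt
        (mem_chart_source (Cn m) x) (mem_chart_source (Cn n) (f x)))
    filter_upwards [hdom] with t ⟨hγt, hfγt⟩
    choose V hV using fun i => (coords_bijective hφ (φ.map_target hγt)).2 (X i t)
    refine ⟨φ.symm (γ t), V, ?_, ?_⟩ <;> ext i j
    · simp only [gram, of_apply, g.inner_symm_eq_sesqForm hφ hγt, hV]
    · simp only [gram, of_apply, pullInner_symm_eq_sesqForm h hf hφ hψ hγt hfγt, hV]
  · simpa using g.hasJet_inner hγ (hX i) (hX j)

end FieldsAlongDiscs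

section UnitaryFrames

variable {X : Type*} [TopologicalSpace X] {m l : ℕ} {A : X → Matrix (Fin m) (Fin m) ℂ} {K : Set X}

theorem continuousOn_sesqForm {c c' : X → Cn m} (hA : ∀ i j, ContinuousOn (fun p => A p i j) K)
    (hc : ContinuousOn c K) (hc' : ContinuousOn c' K) :
    ContinuousOn (fun p => sesqForm (A p) (c p) (c' p)) K := by
  simp only [sesqForm_eq_sum]
  refine continuousOn_finsetSum _ fun i _ => continuousOn_finsetSum _ fun j _ => ?_
  fun_prop

theorem sesqForm_smul_smul (A : Matrix (Fin m) (Fin m) ℂ) (a b : ℂ) (c c' : Cn m) :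
    sesqForm A (a • c) (b • c') = a * conj b * sesqForm A c c' := by
  simp only [sesqForm_eq_sum, PiLp.smul_apply, smul_eq_mul, map_mul, Finset.mul_sum]
  refine Finset.sum_congr rfl fun i _ => Finset.sum_congr rfl fun j _ => ?_
  ring

theorem exists_pos_mul_sq_norm_le_sesqForm (hK : IsCompact K)
    (hA : ∀ i j, ContinuousOn (fun z => A z i j) K)
    (hpos : ∀ z ∈ K, ∀ c : Cn m, c ≠ 0 → 0 < (sesqForm (A z) c c).re) :
    ∃ ε : ℝ, 0 < ε ∧ ∀ z ∈ K, ∀ c : Cn m, ε * ‖c‖ ^ 2 ≤ (sesqForm (A z) c c).re := by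
  obtain ⟨ε, hε, hmin⟩ : ∃ ε : ℝ, 0 < ε ∧ ∀ p ∈ K ×ˢ Metric.sphere (0 : Cn m) 1,
      ε ≤ (sesqForm (A p.1) p.2 p.2).re := by
    refine (hK.prod (isCompact_sphere (0 : Cn m) 1)).exists_forall_le' ?_ fun p hp =>
      hpos _ hp.1 _ (Metric.ne_of_mem_sphere hp.2 one_ne_zero)
    exact Complex.continuous_re.comp_continuousOn (continuousOn_sesqForm
      (fun i j => (hA i j).comp continuousOn_fst fun p hp => hp.1) continuousOn_snd
      continuousOn_snd)
  refine ⟨ε, hε, fun z hz c => ?_⟩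
  by_cases hc : c = 0
  · simp [hc, sesqForm]
  have hc' : ‖c‖ ≠ 0 := norm_ne_zero_iff.2 hc
  have hsphere : ((‖c‖⁻¹ : ℝ) : ℂ) • c ∈ Metric.sphere (0 : Cn m) 1 := by simp [norm_smul, hc']
  have hunit := hmin (z, ((‖c‖⁻¹ : ℝ) : ℂ) • c) ⟨hz, hsphere⟩
  rw [sesqForm_smul_smul, Complex.conj_ofReal, ← Complex.ofReal_mul,
    Complex.re_ofReal_mul] at hunit
  calc ε * ‖c‖ ^ 2 ≤ (‖c‖⁻¹ * ‖c‖⁻¹ * (sesqForm (A z) c c).re) * ‖c‖ ^ 2 := by gcongr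
    _ = (sesqForm (A z) c c).re := by field_simp

/-- The unitary families of `l` vectors over `K` for the Hermitian metric with matrix `A`, as
families of component vectors. -/
def unitaryFrames (A : X → Matrix (Fin m) (Fin m) ℂ) (K : Set X) (l : ℕ) :
    Set (X × (Fin l → Cn m)) :=
  {p | p.1 ∈ K ∧ ∀ i j, sesqForm (A p.1) (p.2 i) (p.2 j) = if i = j then 1 else 0}

theorem isClosed_unitaryFrames (hK : IsClosed K) (hA : ∀ i j, ContinuousOn (fun z => A z i j) K) :
    IsClosed (unitaryFrames A K l) := by
  have hcont : ContinuousOn (fun p : X × (Fin l → Cn m) =>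
      (fun i j => sesqForm (A p.1) (p.2 i) (p.2 j) : Fin l → Fin l → ℂ)) (K ×ˢ Set.univ) := by
    refine continuousOn_pi.2 fun i => continuousOn_pi.2 fun j => ?_
    refine continuousOn_sesqForm (fun a b => ?_) (by fun_prop) (by fun_prop)
    exact (hA a b).comp continuousOn_fst fun p hp => hp.1
  convert hcont.preimage_isClosed_of_isClosed (hK.prod isClosed_univ)
    (isClosed_singleton (x := fun i j : Fin l => if i = j then (1 : ℂ) else 0)) using 1
  ext p
  simp [unitaryFrames, funext_iff]

theorem isCompact_unitaryFrames [T2Space X] (hK : IsCompact K)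
    (hA : ∀ i j, ContinuousOn (fun z => A z i j) K)
    (hpos : ∀ z ∈ K, ∀ c : Cn m, c ≠ 0 → 0 < (sesqForm (A z) c c).re) :
    IsCompact (unitaryFrames A K l) := by
  obtain ⟨ε, hε, hcoercive⟩ := exists_pos_mul_sq_norm_le_sesqForm hK hA hpos
  refine (hK.prod (isCompact_closedBall (0 : Fin l → Cn m) √ε⁻¹)).of_isClosed_subset
    (isClosed_unitaryFrames hK.isClosed hA) fun p ⟨hpK, hp⟩ => ⟨hpK, ?_⟩
  rw [mem_closedBall_zero_iff, pi_norm_le_iff_of_nonneg (Real.sqrt_nonneg _)]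
  intro i
  have hi := hcoercive p.1 hpK (p.2 i)
  rw [hp i i, if_pos rfl, Complex.one_re] at hi
  exact Real.le_sqrt_of_sq_le (by rwa [← one_div, le_div_iff₀' hε])

end UnitaryFrames

theorem exists_forall_le_of_locally {X α β : Type*} [TopologicalSpace X] [CompactSpace X]
    [LinearOrder α] [Nonempty β] (π : β → X) (F : β → α)
    (hF : ∀ x, ∃ U ∈ 𝓝 x, ∃ b, ∀ b', π b' ∈ U → F b' ≤ F b) : ∃ b, ∀ b', F b' ≤ F b := by
  have hmax := isCompact_univ.induction_on
    (p := fun U : Set X => ∃ b, ∀ b', π b' ∈ U → F b' ≤ F b)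
    ⟨Classical.arbitrary β, fun _ hb' => hb'.elim⟩
    (fun s t hst ⟨b, hb⟩ => ⟨b, fun b' hb' => hb b' (hst hb')⟩)
    (fun s t ⟨b₁, h₁⟩ ⟨b₂, h₂⟩ => ?_)
    (fun x _ => (hF x).imp fun U hU => ⟨mem_nhdsWithin_of_mem_nhds hU.1, hU.2⟩)
  · exact hmax.imp fun b hb b' => hb b' trivial
  · rcases le_total (F b₁) (F b₂) with hle | hle
    · exact ⟨b₂, fun b' hb' => hb'.elim (fun hs => (h₁ b' hs).trans hle) (h₂ b')⟩
    · exact ⟨b₁, fun b' hb' => hb'.elim (h₁ b') fun ht => (h₂ b' ht).trans hle⟩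

section Maximum

variable {m n l : ℕ} {M N : Type*} [TopologicalSpace M] [ChartedSpace (Cn m) M]
  [TopologicalSpace N] [ChartedSpace (Cn n) N] {f : M → N}
  {φ : OpenPartialHomeomorph M (Cn m)} {ψ : OpenPartialHomeomorph N (Cn n)} {K : Set (Cn m)}

namespace HermitianMetric

theorem isUnitary_iff_gram_eq_one {g : HermitianMetric m M} {x : M} {e : Fin l → T m x} :
    g.IsUnitary x e ↔ gram (g.inner x) e = 1 := by
  simp only [IsUnitary, ← Matrix.ext_iff, gram, of_apply, one_apply]

/-- The unitary families of `l` tangent vectors at the points of `M`. -/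
def UnitaryFrame (g : HermitianMetric m M) (l : ℕ) : Type _ :=
  Σ x : M, {e : Fin l → T m x // g.IsUnitary x e}

theorem nonempty_unitaryFrame (g : HermitianMetric m M) (hl : l ≤ m) (x : M) :
    Nonempty (g.UnitaryFrame l) :=
  let ⟨e, he, _⟩ := g.exists_isUnitary_eq_sum_smul hl (0 : Fin l → T m x)
  ⟨x, e, he⟩

variable [IsManifold 𝓘(ℂ, Cn m) 1 M]

theorem isUnitary_symm_iff_mem_unitaryFrames {g : HermitianMetric m M} (hφ : φ ∈ atlas (Cn m) M)
    (hK : K ⊆ φ.target) {z : Cn m} (hz : z ∈ K) {e : Fin l → T m (φ.symm z)} :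
    g.IsUnitary (φ.symm z) e
      ↔ (z, fun i => coords φ (φ.symm z) (e i)) ∈ unitaryFrames (g.matrix φ) K l := by
  simp only [IsUnitary, unitaryFrames, Set.mem_ofPred_eq, hz, true_and,
    g.inner_symm_eq_sesqForm hφ (hK hz)]

theorem isCompact_unitaryFrames (g : HermitianMetric m M) (hφ : φ ∈ atlas (Cn m) M)
    (hK : IsCompact K) (hKφ : K ⊆ φ.target) : IsCompact (unitaryFrames (g.matrix φ) K l) := by
  refine HermitianGeometry.isCompact_unitaryFrames hK
    (fun i j z hz => (g.contDiffAt_matrix hφ (hKφ hz) i j).continuousAt.continuousWithinAt)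
    fun z hz c hc => ?_
  obtain ⟨u, rfl⟩ := (coords_bijective hφ (φ.map_target (hKφ hz))).2 c
  rw [← g.inner_symm_eq_sesqForm hφ (hKφ hz)]
  refine g.pos _ _ ?_
  rintro rfl
  exact hc (map_zero _)

end HermitianMetric

/-- The Gram matrix for `f*h` of the family of tangent vectors at `p.1` with component vectors
`p.2`, in charts where `f` has the expression `F` and `h` the matrix `A`. -/
def pullbackGram (A : Cn n → Matrix (Fin n) (Fin n) ℂ) (F : Cn m → Cn n)
    (p : Cn m × (Fin l → Cn m)) : Matrix (Fin l) (Fin l) ℂ :=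
  of fun i j => sesqForm (A (F p.1)) (fderiv ℂ F p.1 (p.2 i)) (fderiv ℂ F p.1 (p.2 j))

theorem continuousOn_pullbackGram {A : Cn n → Matrix (Fin n) (Fin n) ℂ} {F : Cn m → Cn n}
    (hF : ∀ z ∈ K, AnalyticAt ℂ F z) (hA : ∀ z ∈ K, ∀ i j, ContinuousAt (fun w => A w i j) (F z)) :
    ContinuousOn (pullbackGram (l := l) A F) (K ×ˢ Set.univ) := by
  refine continuousOn_pi.2 fun i => continuousOn_pi.2 fun j => ?_
  have hdF : ContinuousOn (fun p : Cn m × (Fin l → Cn m) => fderiv ℂ F p.1) (K ×ˢ Set.univ) :=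
    ContinuousOn.comp (t := K) (fun z hz => (hF z hz).fderiv.continuousAt.continuousWithinAt)
      continuousOn_fst fun p hp => hp.1
  refine continuousOn_sesqForm (fun a b => ?_) (hdF.clm_apply (by fun_prop))
    (hdF.clm_apply (by fun_prop))
  refine ContinuousOn.comp (t := K) (g := fun z => A (F z) a b) (fun z hz => ?_) continuousOn_fst
    fun p hp => hp.1
  exact ((hA z hz a b).comp (hF z hz).continuousAt).continuousWithinAt

variable [IsManifold 𝓘(ℂ, Cn m) ω M] [IsManifold 𝓘(ℂ, Cn n) ω N]

theorem exists_forall_le_of_isCompact (g : HermitianMetric m M) (h : HermitianMetric n N)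
    (hf : ContMDiff 𝓘(ℂ, Cn m) 𝓘(ℂ, Cn n) ω f) (hl : l ≤ m)
    {Φ : Matrix (Fin l) (Fin l) ℂ → ℝ} (hΦ : Continuous Φ) (hφ : φ ∈ atlas (Cn m) M)
    (hψ : ψ ∈ atlas (Cn n) N) (hK : IsCompact K) (hK' : K.Nonempty) (hKφ : K ⊆ φ.target)
    (hKψ : ∀ z ∈ K, f (φ.symm z) ∈ ψ.source) :
    ∃ b : g.UnitaryFrame l, ∀ z ∈ K, ∀ e : Fin l → T m (φ.symm z), g.IsUnitary (φ.symm z) e →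
      Φ (gram (pullInner h f (φ.symm z)) e) ≤ Φ (gram (pullInner h f b.1) b.2.1) := by
  have : IsManifold 𝓘(ℂ, Cn m) 1 M := IsManifold.of_le (n := ω) le_top
  have : IsManifold 𝓘(ℂ, Cn n) 1 N := IsManifold.of_le (n := ω) le_top
  have hgram (z) (hz : z ∈ K) (e : Fin l → T m (φ.symm z)) : gram (pullInner h f (φ.symm z)) e
      = pullbackGram (h.matrix ψ) (chartExpr φ ψ f) (z, fun i => coords φ (φ.symm z) (e i)) := by
    ext i j
    simp only [gram, of_apply, pullbackGram,
      pullInner_symm_eq_sesqForm h hf hφ hψ (hKφ hz) (hKψ z hz)]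
  have hcont : ContinuousOn (fun p => Φ (pullbackGram (h.matrix ψ) (chartExpr φ ψ f) p))
      (unitaryFrames (g.matrix φ) K l) := by
    refine hΦ.comp_continuousOn (ContinuousOn.mono (continuousOn_pullbackGram
      (fun z hz => analyticAt_chartExpr hf hφ hψ (hKφ hz) (hKψ z hz))
      fun z hz i j => (h.contDiffAt_matrix hψ (ψ.map_source (hKψ z hz)) i j).continuousAt)
      fun p hp => ⟨hp.1, trivial⟩)
  have hne : (unitaryFrames (g.matrix φ) K l).Nonempty := by
    obtain ⟨z, hz⟩ := hK'
    obtain ⟨e, he, -⟩ := g.exists_isUnitary_eq_sum_smul hl (0 : Fin l → T m (φ.symm z))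
    exact ⟨_, (HermitianMetric.isUnitary_symm_iff_mem_unitaryFrames hφ hKφ hz).1 he⟩
  obtain ⟨⟨z₀, c⟩, hmem, hmax⟩ := (g.isCompact_unitaryFrames hφ hK hKφ).exists_isMaxOn hne hcont
  choose e₀ he₀ using fun i => (coords_bijective hφ (φ.map_target (hKφ hmem.1))).2 (c i)
  have hc : (fun i => coords φ (φ.symm z₀) (e₀ i)) = c := funext he₀
  have hunitary : g.IsUnitary (φ.symm z₀) e₀ := by
    rwa [HermitianMetric.isUnitary_symm_iff_mem_unitaryFrames hφ hKφ hmem.1, hc]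
  refine ⟨⟨φ.symm z₀, e₀, hunitary⟩, fun z hz e he => ?_⟩
  rw [hgram z hz, hgram z₀ hmem.1, hc]
  exact hmax ((HermitianMetric.isUnitary_symm_iff_mem_unitaryFrames hφ hKφ hz).1 he)

theorem exists_isUnitary_forall_le [CompactSpace M] (g : HermitianMetric m M)
    (h : HermitianMetric n N) (hf : ContMDiff 𝓘(ℂ, Cn m) 𝓘(ℂ, Cn n) ω f) (hl : l ≤ m)
    {Φ : Matrix (Fin l) (Fin l) ℂ → ℝ} (hΦ : Continuous Φ) (x : M) :
    ∃ (x₀ : M) (e₀ : Fin l → T m x₀), g.IsUnitary x₀ e₀ ∧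
      ∀ (y : M) (e : Fin l → T m y), g.IsUnitary y e →
        Φ (gram (pullInner h f y) e) ≤ Φ (gram (pullInner h f x₀) e₀) := by
  have := g.nonempty_unitaryFrame hl x
  suffices hlocal : ∀ y, ∃ U ∈ 𝓝 y, ∃ b : g.UnitaryFrame l, ∀ b' : g.UnitaryFrame l, b'.1 ∈ U →
      Φ (gram (pullInner h f b'.1) b'.2.1) ≤ Φ (gram (pullInner h f b.1) b.2.1) by
    obtain ⟨⟨x₀, e₀, he₀⟩, hmax⟩ := exists_forall_le_of_locally (β := g.UnitaryFrame l) Sigma.fst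
      (fun b => Φ (gram (pullInner h f b.1) b.2.1)) hlocal
    exact ⟨x₀, e₀, he₀, fun y e he => hmax ⟨y, e, he⟩⟩
  intro y
  have hy := mem_chart_source (Cn m) y
  obtain ⟨K, hKy, hKsub, hK⟩ := local_compact_nhds (eventually_mem_target_and_mem_source
    hf.continuous.continuousAt hy (mem_chart_source (Cn n) (f y)))
  obtain ⟨b, hb⟩ := exists_forall_le_of_isCompact g h hf hl hΦ (chart_mem_atlas _ y)
    (chart_mem_atlas _ (f y)) hK ⟨_, mem_of_mem_nhds hKy⟩ (fun z hz => (hKsub hz).1)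
    fun z hz => (hKsub hz).2
  refine ⟨_, inter_mem ((chartAt (Cn m) y).open_source.mem_nhds hy)
    (((chartAt (Cn m) y).continuousAt hy).preimage_mem_nhds hKy), b, ?_⟩
  rintro ⟨y', e, he⟩ ⟨hy', hy'K⟩
  obtain ⟨z, hz, rfl⟩ : ∃ z ∈ K, (chartAt (Cn m) y).symm z = y' :=
    ⟨_, hy'K, (chartAt (Cn m) y).left_inv hy'⟩
  exact hb z hz e he

end Maximum

section MatrixJets

variable {ι : Type*} [Fintype ι] {G H : ℂ → Matrix ι ι ℂ} {B B' DG DH : Matrix ι ι ℂ}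

theorem trace_mul_conjTranspose_re (B : Matrix ι ι ℂ) :
    (B * Bᴴ).trace.re = ∑ i, ∑ j, Complex.normSq (B i j) := by
  simp only [Matrix.trace, diag_apply, mul_apply, conjTranspose_apply, ← starRingEnd_apply,
    Complex.mul_conj, Complex.re_sum, Complex.ofReal_re]

variable [DecidableEq ι]

theorem trace_re_sub_sum_normSq_le_of_det_re_le
    (hG : ∀ i j, HasJet (fun t => G t i j) (mixedJet ((1 : Matrix ι ι ℂ) i j) 0 0 (DG i j)))
    (hH : ∀ i j, HasJet (fun t => H t i j)
      (mixedJet ((1 : Matrix ι ι ℂ) i j) (B i j) (Bᴴ i j) (DH i j)))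
    (hle : ∀ᶠ t in 𝓝 0, (H t).det.re ≤ (G t).det.re) :
    DH.trace.re - ∑ i, ∑ j, Complex.normSq (B i j) ≤ DG.trace.re := by
  have hdetG := (HasJet.det hG).congr_jet (det_mixedJet 0 0 DG)
  have hdetH := (HasJet.det hH).congr_jet (det_mixedJet B Bᴴ DH)
  have hd := ((hdetH.sub hdetG).congr_jet (mixedJet_sub ..)).re_nonpos_of_isLocalMax <|
    hle.mono fun t ht => by simpa using ht
  have htrace : 0 ≤ (B.trace * Bᴴ.trace).re := by
    rw [trace_conjTranspose, ← starRingEnd_apply, Complex.mul_conj, Complex.ofReal_re]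
    exact Complex.normSq_nonneg _
  simp only [trace_zero, mul_zero, add_zero, sub_zero, Complex.sub_re, Complex.add_re,
    trace_mul_conjTranspose_re] at hd
  linarith

theorem trace_re_le_sum_mul_of_trace_mul_two_sub_re_le {μ : ι → ℝ}
    (hG : ∀ i j, HasJet (fun t => G t i j) (mixedJet ((1 : Matrix ι ι ℂ) i j) 0 0 (DG i j)))
    (hH : ∀ i j, HasJet (fun t => H t i j)
      (mixedJet (diagonal (fun i => (μ i : ℂ)) i j) (B i j) (B' i j) (DH i j)))
    (hle : ∀ᶠ t in 𝓝 0, (H t * (2 - G t)).trace.re ≤ ∑ i, μ i) :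
    DH.trace.re ≤ ∑ i, μ i * (DG i i).re := by
  have hjet : HasJet (fun t => (H t * (2 - G t)).trace)
      (mixedJet (∑ i, (μ i : ℂ)) B.trace B'.trace (DH.trace - ∑ i, μ i * DG i i)) := by
    refine (HasJet.sum Finset.univ fun i _ => HasJet.sum Finset.univ fun j _ =>
      (hH i j).mul ((HasJet.const ((2 : Matrix ι ι ℂ) j i)).sub (hG j i))).congr_jet ?_
    have htwo : (2 : Matrix ι ι ℂ) = 1 + 1 := one_add_one_eq_two.symm
    simp [htwo, mixedJet_sub, mixedJet_mul, mixedJet_sum, diagonal_apply, one_apply,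
      Matrix.trace, neg_add_eq_sub]
  have hd := hjet.re_nonpos_of_isLocalMax (hle.mono fun t ht => by simpa using ht)
  simpa using hd

end MatrixJets

section SecondVariation

variable {m n : ℕ} {M N : Type*} [TopologicalSpace M] [ChartedSpace (Cn m) M]
  [IsManifold 𝓘(ℂ, Cn m) ω M]
  [TopologicalSpace N] [ChartedSpace (Cn n) N] [IsManifold 𝓘(ℂ, Cn n) ω N]
  {g : HermitianMetric m M} {h : HermitianMetric n N} {f : M → N} {l : ℕ} {x : M}
  {e : Fin l → T m x}

theorem exists_gram_smul_jets (g : HermitianMetric m M) (h : HermitianMetric n N)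
    (hf : ContMDiff 𝓘(ℂ, Cn m) 𝓘(ℂ, Cn n) ω f) (r : Fin l → ℝ) {E : Fin l → T n (f x)}
    (hE : ∀ i, E i = (r i : ℂ) • tmap f x (e i)) (v : T m x) :
    ∃ (G H : ℂ → Matrix (Fin l) (Fin l) ℂ) (s : Fin l → T n (f x)),
      (∀ᶠ t in 𝓝 0, ∃ (y : M) (V : Fin l → T m y),
        G t = gram (g.inner y) V ∧ H t = gram (pullInner h f y) fun i => (r i : ℂ) • V i) ∧
      (∀ i j, HasJet (fun t => G t i j)
        (mixedJet (g.inner x (e i) (e j)) 0 0 (-g.chern x v v (e i) (e j)))) ∧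
      ∀ i j, HasJet (fun t => H t i j)
        (mixedJet (h.inner (f x) (E i) (E j)) (h.inner (f x) (s i) (E j))
          (h.inner (f x) (E i) (s j)) (h.inner (f x) (s i) (s j)
            - h.chern (f x) (tmap f x v) (tmap f x v) (E i) (E j))) := by
  obtain ⟨G, H, s, hcurve, hG, hH⟩ := exists_gram_jets g h hf e v
  refine ⟨G, fun t => of fun i j => r i * r j * H t i j, fun i => (r i : ℂ) • s i,
    hcurve.mono fun t ⟨y, V, hGt, hHt⟩ => ⟨y, V, hGt, ?_⟩, hG, fun i j => ?_⟩
  · ext i j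
    simp only [hHt, gram, of_apply, map_smul, map_smulₛₗ, LinearMap.smul_apply, smul_eq_mul,
      Complex.conj_ofReal]
    ring
  · have hchern := h.chern_smul (f x) 1 1 (r i) (r j) (tmap f x v) (tmap f x v) (tmap f x (e i))
      (tmap f x (e j))
    simp only [one_smul, map_one, one_mul, Complex.conj_ofReal] at hchern
    refine ((hH i j).const_mul (r i * r j)).congr_jet ?_
    simp only [hE, hchern, mixedJet_mul, pullInner_apply, map_smul, map_smulₛₗ,
      LinearMap.smul_apply, smul_eq_mul, Complex.conj_ofReal, zero_mul, add_zero]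
    congr 1 <;> ring

theorem sum_chern_le_of_det_gram_le (hf : ContMDiff 𝓘(ℂ, Cn m) 𝓘(ℂ, Cn n) ω f) (hl : l ≤ m)
    (he : g.IsUnitary x e) {r : Fin l → ℝ} {E : Fin l → T n (f x)} (hEu : h.IsUnitary (f x) E)
    (hE : ∀ i, E i = (r i : ℂ) • tmap f x (e i))
    (hmax : ∀ (y : M) (u : Fin l → T m y), g.IsUnitary y u →
      (gram (pullInner h f y) u).det.re ≤ (gram (pullInner h f x) e).det.re) (v : T m x) :
    ∑ i, (g.chern x v v (e i) (e i)).re ≤ h.firstRicci (f x) E (tmap f x v) := by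
  obtain ⟨G, H, s, hcurve, hG, hH⟩ := exists_gram_smul_jets g h hf r hE v
  have hnormalized : (gram (pullInner h f x) fun i => (r i : ℂ) • e i) = 1 := by
    rw [← HermitianMetric.isUnitary_iff_gram_eq_one.1 hEu]
    ext i j
    simp [gram, pullInner_apply, hE]
  have hdet : ∀ᶠ t in 𝓝 0, (H t).det.re ≤ (G t).det.re := by
    filter_upwards [hcurve] with t ⟨y, V, hGt, hHt⟩
    obtain ⟨u, hu, C, hC⟩ := g.exists_isUnitary_eq_sum_smul hl V
    rw [hGt, hHt]
    exact det_gram_smul_re_le_det_gram_re hC (HermitianMetric.isUnitary_iff_gram_eq_one.1 hu)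
      hnormalized (hmax y u hu)
  have hsecond := trace_re_sub_sum_normSq_le_of_det_re_le
    (B := of fun i j => h.inner (f x) (s i) (E j)) (DG := of fun i j => -g.chern x v v (e i) (e j))
    (DH := of fun i j => h.inner (f x) (s i) (s j)
      - h.chern (f x) (tmap f x v) (tmap f x v) (E i) (E j))
    (fun i j => (hG i j).congr_jet (by rw [he i j]; rfl))
    (fun i j => (hH i j).congr_jet (by
      rw [hEu i j, conjTranspose_apply, of_apply, of_apply, ← starRingEnd_apply, h.conj_symm]
      rfl)) hdet
  have hbessel := Finset.sum_le_sum fun i (_ : i ∈ Finset.univ) => hEu.sum_normSq_inner_le (s i)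
  simp only [Matrix.trace, diag_apply, of_apply, Complex.re_sum, Complex.sub_re, Complex.neg_re,
    Finset.sum_sub_distrib, Finset.sum_neg_distrib] at hsecond
  rw [HermitianMetric.firstRicci]
  linarith

theorem sum_mul_chern_le_of_trace_gram_le (hf : ContMDiff 𝓘(ℂ, Cn m) 𝓘(ℂ, Cn n) ω f) (hl : l ≤ m)
    (he : g.IsUnitary x e) {μ : Fin l → ℝ}
    (hμ : gram (pullInner h f x) e = diagonal fun i => (μ i : ℂ))
    (hmax : ∀ (y : M) (u : Fin l → T m y), g.IsUnitary y u →
      (gram (pullInner h f y) u).trace.re ≤ (gram (pullInner h f x) e).trace.re) (v : T m x) :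
    ∑ i, μ i * (g.chern x v v (e i) (e i)).re
      ≤ ∑ i, (h.chern (f x) (tmap f x v) (tmap f x v) (tmap f x (e i)) (tmap f x (e i))).re := by
  obtain ⟨G, H, s, hcurve, hG, hH⟩ := exists_gram_jets g h hf e v
  have htrace : ∀ᶠ t in 𝓝 0, (H t * (2 - G t)).trace.re ≤ ∑ i, μ i := by
    filter_upwards [hcurve] with t ⟨y, V, hGt, hHt⟩
    obtain ⟨u, hu, C, hC⟩ := g.exists_isUnitary_eq_sum_smul hl V
    calc (H t * (2 - G t)).trace.re ≤ (gram (pullInner h f y) u).trace.re := by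
          rw [hGt, hHt]
          exact trace_gram_mul_two_sub_gram_re_le (pullInner_self_re_nonneg h f y) hC
            (HermitianMetric.isUnitary_iff_gram_eq_one.1 hu)
      _ ≤ (gram (pullInner h f x) e).trace.re := hmax y u hu
      _ = ∑ i, μ i := by simp [hμ]
  have hsecond := trace_re_le_sum_mul_of_trace_mul_two_sub_re_le
    (B := of fun i j => h.inner (f x) (s i) (tmap f x (e j)))
    (B' := of fun i j => h.inner (f x) (tmap f x (e i)) (s j))
    (DG := of fun i j => -g.chern x v v (e i) (e j))
    (DH := of fun i j => h.inner (f x) (s i) (s j)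
      - h.chern (f x) (tmap f x v) (tmap f x v) (tmap f x (e i)) (tmap f x (e j)))
    (fun i j => (hG i j).congr_jet (by rw [he i j]; rfl))
    (fun i j => (hH i j).congr_jet (by rw [← hμ]; rfl)) htrace
  have hnonneg : 0 ≤ ∑ i, (h.inner (f x) (s i) (s i)).re :=
    Finset.sum_nonneg fun i _ => h.re_inner_self_nonneg _
  simp only [Matrix.trace, diag_apply, of_apply, Complex.re_sum, Complex.sub_re, Complex.neg_re,
    Finset.sum_sub_distrib, mul_neg, Finset.sum_neg_distrib] at hsecond
  linarith

end SecondVariation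

theorem prod_le_div_card_pow {ι : Type*} [Fintype ι] {μ : ι → ℝ} (hμ : ∀ i, 0 ≤ μ i) {c : ℝ}
    (hc : ∑ i, μ i ≤ c) : ∏ i, μ i ≤ (c / Fintype.card ι) ^ Fintype.card ι := by
  rcases isEmpty_or_nonempty ι with hι | hι
  · simp
  have hsum : 0 ≤ ∑ i, μ i := Finset.sum_nonneg fun i _ => hμ i
  have hmean := Real.geom_mean_le_arith_mean Finset.univ (fun _ => 1) μ (by simp)
    (by simp [Fintype.card_pos]) fun i _ => hμ i
  simp only [Real.rpow_one, one_mul, Finset.sum_const, Finset.card_univ, nsmul_eq_mul,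
    mul_one] at hmean
  calc ∏ i, μ i = ((∏ i, μ i) ^ (Fintype.card ι : ℝ)⁻¹) ^ Fintype.card ι :=
        (Real.rpow_inv_natCast_pow (Finset.prod_nonneg fun i _ => hμ i) Fintype.card_ne_zero).symm
    _ ≤ ((∑ i, μ i) / Fintype.card ι) ^ Fintype.card ι :=
        pow_le_pow_left₀ (Real.rpow_nonneg (Finset.prod_nonneg fun i _ => hμ i) _) hmean _
    _ ≤ (c / Fintype.card ι) ^ Fintype.card ι := by gcongr

section RealBisectional

variable {n : ℕ} {N : Type*} [TopologicalSpace N] [ChartedSpace (Cn n) N]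
  {h : HermitianMetric n N} {y : N} {c : ℝ}

theorem HermitianMetric.RealBisectionalLE.sum_sum_mul_le (hh : h.RealBisectionalLE c)
    {e : Fin n → T n y} (he : h.IsUnitary y e) {a : Fin n → ℝ} (ha : ∀ i, 0 ≤ a i) :
    ∑ i, ∑ j, (h.chern y (e i) (e i) (e j) (e j)).re * a i * a j ≤ c * ∑ i, a i ^ 2 := by
  have hsq : 0 ≤ ∑ i, a i ^ 2 := Finset.sum_nonneg fun i _ => sq_nonneg _
  rcases hsq.eq_or_lt' with hzero | hpos
  · have ha0 (i : Fin n) : a i = 0 := by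
      simpa using (Finset.sum_eq_zero_iff_of_nonneg fun i _ => sq_nonneg (a i)).1 hzero i
    simp [ha0]
  · have hle := hh y e he a ha hpos
    rwa [realBisectional, one_div, inv_mul_le_iff₀' hpos] at hle

theorem HermitianMetric.exists_orthogonal_fin (h : HermitianMetric n N) {ι : Type*} [Fintype ι]
    {w : ι → T n y} (horth : ∀ i j, i ≠ j → h.inner y (w i) (w j) = 0) :
    ∃ v : Fin n → T n y, (∀ i j, i ≠ j → h.inner y (v i) (v j) = 0) ∧
      ∀ F : T n y → ℝ, F 0 = 0 → ∑ i, F (w i) = ∑ k, F (v k) := by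
  classical
  have hcard := h.card_le_of_orthogonal (v := fun i : {i // w i ≠ 0} => w i) (fun i => i.2)
    fun i j hij => horth i j (Subtype.coe_injective.ne hij)
  obtain ⟨σ⟩ := Function.Embedding.nonempty_of_card_le (hcard.trans_eq (Fintype.card_fin n).symm)
  set v : Fin n → T n y := Function.extend σ (fun i => w i) 0
  have hσ (i) : v (σ i) = w i := σ.injective.extend_apply _ _ i
  have hnot {k} (hk : k ∉ Set.range σ) : v k = 0 := Function.extend_apply' _ _ _ hk
  refine ⟨v, fun i j hij => ?_, fun F hF => ?_⟩
  · by_cases hi : i ∈ Set.range σ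
    · by_cases hj : j ∈ Set.range σ
      · obtain ⟨i, rfl⟩ := hi
        obtain ⟨j, rfl⟩ := hj
        rw [hσ, hσ]
        exact horth _ _ fun heq => hij (congrArg σ (Subtype.ext heq))
      · rw [hnot hj, map_zero]
    · rw [hnot hi, map_zero, LinearMap.zero_apply]
  · calc ∑ i, F (w i) = ∑ i : {i // w i ≠ 0}, F (w i) :=
          (Fintype.sum_of_injective _ Subtype.coe_injective _ _
            (fun i hi => by rw [not_ne_iff.1 fun h0 => hi ⟨⟨i, h0⟩, rfl⟩, hF]) fun _ => rfl).symm
      _ = ∑ k, F (v k) := Fintype.sum_of_injective σ σ.injective _ _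
          (fun k hk => by rw [hnot hk, hF]) fun i => by rw [hσ]

theorem HermitianMetric.RealBisectionalLE.sum_sum_chern_le (hh : h.RealBisectionalLE c)
    {ι : Type*} [Fintype ι] {w : ι → T n y} (horth : ∀ i j, i ≠ j → h.inner y (w i) (w j) = 0) :
    ∑ i, ∑ j, (h.chern y (w i) (w i) (w j) (w j)).re ≤ c * ∑ i, (h.inner y (w i) (w i)).re ^ 2 := by
  obtain ⟨v, hv, hsum⟩ := h.exists_orthogonal_fin horth
  obtain ⟨b, hb, hvb⟩ := h.exists_isUnitary_of_orthogonal v hv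
  have hpos (i) : 0 ≤ (h.inner y (v i) (v i)).re := h.re_inner_self_nonneg _
  have hleft (u : T n y) : h.chern y 0 0 u u = 0 := by simpa using h.chern_smul y 0 0 1 1 0 0 u u
  have hright (u : T n y) : h.chern y u u 0 0 = 0 := by simpa using h.chern_smul y 1 1 0 0 u u 0 0
  have hchern (i j) : (h.chern y (v i) (v i) (v j) (v j)).re
      = (h.chern y (b i) (b i) (b j) (b j)).re * (h.inner y (v i) (v i)).re
        * (h.inner y (v j) (v j)).re := by
    conv_lhs => rw [hvb i, hvb j]
    rw [h.chern_smul, Complex.conj_ofReal, Complex.conj_ofReal, ← Complex.ofReal_mul,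
      mul_assoc ((_ : ℝ) : ℂ) (Complex.ofReal _), ← Complex.ofReal_mul,
      Real.mul_self_sqrt (hpos i), Real.mul_self_sqrt (hpos j), ← Complex.ofReal_mul,
      Complex.re_ofReal_mul]
    ring
  calc ∑ i, ∑ j, (h.chern y (w i) (w i) (w j) (w j)).re
      = ∑ i, ∑ j, (h.chern y (v i) (v i) (v j) (v j)).re := by
        simp only [fun i => hsum (fun u => (h.chern y (w i) (w i) u u).re) (by simp [hright])]
        exact hsum (fun u => ∑ k, (h.chern y u u (v k) (v k)).re) (by simp [hleft])
    _ ≤ c * ∑ i, (h.inner y (v i) (v i)).re ^ 2 := by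
        simp only [hchern]
        exact hh.sum_sum_mul_le hb hpos
    _ = c * ∑ i, (h.inner y (w i) (w i)).re ^ 2 := by
        rw [hsum (fun u => (h.inner y u u).re ^ 2) (by simp)]

end RealBisectional

section SchwarzLemma

variable {m n : ℕ} {M N : Type*} [TopologicalSpace M] [ChartedSpace (Cn m) M]
  [TopologicalSpace N] [ChartedSpace (Cn n) N]
  {g : HermitianMetric m M} {h : HermitianMetric n N} {f : M → N} {l : ℕ} {x : M}
  {e : Fin l → T m x} {μ : Fin l → ℝ} {K κ c c' : ℝ}

theorem inner_tmap_of_gram_eq_diagonal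
    (hμ : gram (pullInner h f x) e = diagonal fun i => (μ i : ℂ)) (i j : Fin l) :
    h.inner (f x) (tmap f x (e i)) (tmap f x (e j)) = if i = j then (μ i : ℂ) else 0 :=
  (congrFun₂ hμ i j).trans (diagonal_apply ..)

theorem nonneg_of_gram_eq_diagonal
    (hμ : gram (pullInner h f x) e = diagonal fun i => (μ i : ℂ)) (i : Fin l) : 0 ≤ μ i := by
  simpa [inner_tmap_of_gram_eq_diagonal hμ] using h.re_inner_self_nonneg (tmap f x (e i))

theorem isUnitary_inv_sqrt_smul_tmap
    (hμ : gram (pullInner h f x) e = diagonal fun i => (μ i : ℂ)) (hpos : ∀ i, 0 < μ i) :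
    h.IsUnitary (f x) fun i => (((√(μ i))⁻¹ : ℝ) : ℂ) • tmap f x (e i) := by
  intro i j
  simp only [map_smul, map_smulₛₗ, LinearMap.smul_apply, smul_eq_mul, Complex.conj_ofReal,
    inner_tmap_of_gram_eq_diagonal hμ]
  split_ifs with hij
  · subst hij
    rw [← Complex.ofReal_mul, ← Complex.ofReal_mul, ← mul_assoc, ← mul_inv,
      Real.mul_self_sqrt (hpos i).le, inv_mul_cancel₀ (hpos i).ne', Complex.ofReal_one]
  · simp

variable [IsManifold 𝓘(ℂ, Cn m) ω M] [IsManifold 𝓘(ℂ, Cn n) ω N]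

theorem lScalar_le_mul_sum_of_det_gram_le (hf : ContMDiff 𝓘(ℂ, Cn m) 𝓘(ℂ, Cn n) ω f) (hl : l ≤ m)
    (he : g.IsUnitary x e) (hμ : gram (pullInner h f x) e = diagonal fun i => (μ i : ℂ))
    (hpos : ∀ i, 0 < μ i)
    (hmax : ∀ (y : M) (u : Fin l → T m y), g.IsUnitary y u →
      (gram (pullInner h f y) u).det.re ≤ (gram (pullInner h f x) e).det.re)
    (hh : h.FirstRicciLE l c) : g.lScalar x e ≤ c * ∑ i, μ i := by
  have hE := isUnitary_inv_sqrt_smul_tmap hμ hpos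
  set E : Fin l → T n (f x) := fun i => (((√(μ i))⁻¹ : ℝ) : ℂ) • tmap f x (e i)
  have hmem (i : Fin l) : tmap f x (e i) ∈ Submodule.span ℂ (Set.range E) := by
    have hs : (((√(μ i))⁻¹ : ℝ) : ℂ) ≠ 0 := by
      exact_mod_cast inv_ne_zero (Real.sqrt_ne_zero'.2 (hpos i))
    exact (Submodule.smul_mem_iff _ hs).1 (Submodule.subset_span ⟨i, rfl⟩)
  rw [HermitianMetric.lScalar, Finset.mul_sum]
  refine Finset.sum_le_sum fun i _ =>
    (sum_chern_le_of_det_gram_le hf hl he hE (fun _ => rfl) hmax (e i)).trans ?_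
  simpa [inner_tmap_of_gram_eq_diagonal hμ] using
    hh (f x) _ hE.isUnitaryBasis_span.1 _ hE.isUnitaryBasis_span.2 _ (hmem i)

theorem mul_sum_le_mul_sum_sq_of_trace_gram_le (hf : ContMDiff 𝓘(ℂ, Cn m) 𝓘(ℂ, Cn n) ω f)
    (hl : l ≤ m) (he : g.IsUnitary x e)
    (hμ : gram (pullInner h f x) e = diagonal fun i => (μ i : ℂ))
    (hmax : ∀ (y : M) (u : Fin l → T m y), g.IsUnitary y u →
      (gram (pullInner h f y) u).trace.re ≤ (gram (pullInner h f x) e).trace.re)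
    (hg : g.SecondRicciGE l c) (hh : h.RealBisectionalLE c') :
    c * ∑ i, μ i ≤ c' * ∑ i, μ i ^ 2 := by
  have hricci (j) : c ≤ ∑ i, (g.chern x (e i) (e i) (e j) (e j)).re := by
    simpa [he j j, HermitianMetric.secondRicci] using
      hg x _ he.isUnitaryBasis_span.1 e he.isUnitaryBasis_span.2 (e j)
        (Submodule.subset_span ⟨j, rfl⟩)
  have hinner := inner_tmap_of_gram_eq_diagonal hμ
  calc c * ∑ j, μ j = ∑ j, μ j * c := by rw [Finset.mul_sum]; simp only [mul_comm]
    _ ≤ ∑ j, μ j * ∑ i, (g.chern x (e i) (e i) (e j) (e j)).re := Finset.sum_le_sum fun j _ =>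
        mul_le_mul_of_nonneg_left (hricci j) (nonneg_of_gram_eq_diagonal hμ j)
    _ = ∑ i, ∑ j, μ j * (g.chern x (e i) (e i) (e j) (e j)).re := by
        rw [Finset.sum_comm]
        simp only [Finset.mul_sum]
    _ ≤ ∑ i, ∑ j, (h.chern (f x) (tmap f x (e i)) (tmap f x (e i)) (tmap f x (e j))
          (tmap f x (e j))).re := Finset.sum_le_sum fun i _ =>
        sum_mul_chern_le_of_trace_gram_le hf hl he hμ hmax (e i)
    _ ≤ c' * ∑ i, μ i ^ 2 := by
        simpa [hinner] using hh.sum_sum_chern_le (w := fun i => tmap f x (e i))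
          fun i j hij => by rw [hinner, if_neg hij]

variable [CompactSpace M]

theorem det_gram_pullInner_le (hf : ContMDiff 𝓘(ℂ, Cn m) 𝓘(ℂ, Cn n) ω f) (hl : l ≤ m)
    (hK : 0 ≤ K) (hκ : 0 < κ)
    (hg : ∀ (y : M) (u : Fin l → T m y), g.IsUnitary y u → -K ≤ g.lScalar y u)
    (hh : h.FirstRicciLE l (-κ)) (he : g.IsUnitary x e) :
    (gram (pullInner h f x) e).det.re ≤ (K / (l * κ)) ^ l := by
  obtain ⟨x₀, u, hu, hmax⟩ := exists_isUnitary_forall_le g h hf hl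
    (Φ := fun A => A.det.re) (Complex.continuous_re.comp continuous_id.matrix_det) x
  obtain ⟨w, μ, hw, hμ, hdet, -⟩ := exists_gram_eq_diagonal (pullInner_conj_symm h f x₀)
    (HermitianMetric.isUnitary_iff_gram_eq_one.1 hu)
  rw [← HermitianMetric.isUnitary_iff_gram_eq_one] at hw
  rw [← hdet] at hmax
  refine (hmax x e he).trans ?_
  have hprod : (gram (pullInner h f x₀) w).det.re = ∏ i, μ i := by
    rw [hμ, det_diagonal, ← Complex.ofReal_prod, Complex.ofReal_re]
  rw [hprod]
  have hμ0 := nonneg_of_gram_eq_diagonal hμ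
  by_cases hpos : ∀ i, 0 < μ i
  · have hbound := (hg x₀ w hw).trans (lScalar_le_mul_sum_of_det_gram_le hf hl hw hμ hpos hmax hh)
    have hsum : ∑ i, μ i ≤ K / κ := by
      rw [le_div_iff₀ hκ]
      linarith
    simpa [div_div, mul_comm] using prod_le_div_card_pow hμ0 hsum
  · push Not at hpos
    obtain ⟨i, hi⟩ := hpos
    rw [Finset.prod_eq_zero (Finset.mem_univ i) (hi.antisymm (hμ0 i))]
    positivity

theorem trace_gram_pullInner_le (hf : ContMDiff 𝓘(ℂ, Cn m) 𝓘(ℂ, Cn n) ω f) (hl : l ≤ m)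
    (hK : 0 ≤ K) (hκ : 0 < κ) (hg : g.SecondRicciGE l (-K)) (hh : h.RealBisectionalLE (-κ))
    (he : g.IsUnitary x e) : (gram (pullInner h f x) e).trace.re ≤ l * K / κ := by
  obtain ⟨x₀, u, hu, hmax⟩ := exists_isUnitary_forall_le g h hf hl
    (Φ := fun A => A.trace.re) (Complex.continuous_re.comp continuous_id.matrix_trace) x
  obtain ⟨w, μ, hw, hμ, -, htrace⟩ := exists_gram_eq_diagonal (pullInner_conj_symm h f x₀)
    (HermitianMetric.isUnitary_iff_gram_eq_one.1 hu)
  rw [← HermitianMetric.isUnitary_iff_gram_eq_one] at hw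
  rw [← htrace] at hmax
  refine (hmax x e he).trans ?_
  have hsum : (gram (pullInner h f x₀) w).trace.re = ∑ i, μ i := by simp [hμ]
  have hbound := mul_sum_le_mul_sum_sq_of_trace_gram_le hf hl hw hμ hmax hg hh
  have hcauchy : (∑ i, μ i) ^ 2 ≤ l * ∑ i, μ i ^ 2 := by
    simpa using sq_sum_le_card_mul_sum_sq (s := Finset.univ) (f := μ)
  rw [hsum]
  rcases (Finset.sum_nonneg fun i _ => nonneg_of_gram_eq_diagonal hμ i :
    0 ≤ ∑ i, μ i).eq_or_lt with hzero | hpos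
  · rw [← hzero]
    positivity
  · rw [le_div_iff₀ hκ]
    refine le_of_mul_le_mul_right ?_ hpos
    calc (∑ i, μ i) * κ * ∑ i, μ i = κ * (∑ i, μ i) ^ 2 := by ring
      _ ≤ κ * (l * ∑ i, μ i ^ 2) := by gcongr
      _ = l * (κ * ∑ i, μ i ^ 2) := by ring
      _ ≤ l * (K * ∑ i, μ i) := 
        mul_le_mul_of_nonneg_left (by linarith) (Nat.cast_nonneg l)
      _ = l * K * ∑ i, μ i := by ring

theorem volumeRatio_le (hf : ContMDiff 𝓘(ℂ, Cn m) 𝓘(ℂ, Cn n) ω f)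
    (hK : 0 ≤ K) (hκ : 0 < κ) (hg : ∀ x, -K ≤ g.chernScalar x) (hh : h.FirstRicciLE m (-κ))
    (x : M) : volumeRatio g h f x ≤ (K / (m * κ)) ^ m := by
  have : IsManifold 𝓘(ℂ, Cn m) 1 M := IsManifold.of_le (n := ω) le_top
  obtain ⟨u, hu, C, hC⟩ := g.exists_isUnitary_eq_sum_smul le_rfl
    (coordVec (chartAt (Cn m) x) (chartAt (Cn m) x x))
  have hdet := det_gram_pullInner_le hf le_rfl hK hκ
    (fun y e he => (hg y).trans_eq (he.chernScalar_eq_lScalar)) hh hu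
  change ((gram (pullInner h f _) _).det / (gram (g.inner _) _).det).re ≤ _
  rw [det_gram_of_eq_sum_smul _ hC, det_gram_of_eq_sum_smul _ hC,
    HermitianMetric.isUnitary_iff_gram_eq_one.1 hu, det_one, mul_one]
  by_cases hC0 : (Complex.normSq C.det : ℂ) = 0
  · rw [hC0, div_zero, Complex.zero_re]
    positivity
  · rwa [mul_div_cancel_left₀ _ hC0]

theorem wedgeNorm_tmap_div_le (hf : ContMDiff 𝓘(ℂ, Cn m) 𝓘(ℂ, Cn n) ω f) (hl : l ≤ m)
    (hK : 0 ≤ K) (hκ : 0 < κ) (hg : g.LScalarGE l (-K)) (hh : h.FirstRicciLE l (-κ))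
    (v : Fin l → T m x) :
    h.wedgeNorm (f x) (fun i => tmap f x (v i)) / g.wedgeNorm x v ≤ √((K / (l * κ)) ^ l) := by
  obtain ⟨u, hu, C, hC⟩ := g.exists_isUnitary_eq_sum_smul hl v
  have hdet := det_gram_pullInner_le hf hl hK hκ
    (fun y e he => hg y _ he.isUnitaryBasis_span.1 e he.isUnitaryBasis_span.2) hh hu
  change √(gram (pullInner h f x) v).det.re / √(gram (g.inner x) v).det.re ≤ _
  refine div_le_of_le_mul₀ (Real.sqrt_nonneg _) (Real.sqrt_nonneg _) ?_
  rw [← Real.sqrt_mul (by positivity)]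
  exact Real.sqrt_le_sqrt (det_gram_re_le_mul_det_gram_re hC
    (HermitianMetric.isUnitary_iff_gram_eq_one.1 hu) hdet)

theorem wedgeMapNorm_sq_le (hf : ContMDiff 𝓘(ℂ, Cn m) 𝓘(ℂ, Cn n) ω f) (hl : l ≤ m)
    (hK : 0 ≤ K) (hκ : 0 < κ) (hg : g.LScalarGE l (-K)) (hh : h.FirstRicciLE l (-κ)) (x : M) :
    wedgeMapNorm g h f l x ^ 2 ≤ (K / (l * κ)) ^ l := by
  have hnonneg : 0 ≤ wedgeMapNorm g h f l x := by
    refine Real.sSup_nonneg ?_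
    rintro _ ⟨v, -, rfl⟩
    exact div_nonneg (Real.sqrt_nonneg _) (Real.sqrt_nonneg _)
  refine (Real.le_sqrt hnonneg (by positivity)).1 (Real.sSup_le ?_ (Real.sqrt_nonneg _))
  rintro _ ⟨v, -, rfl⟩
  exact wedgeNorm_tmap_div_le hf hl hK hκ hg hh v

theorem sigma_le (hf : ContMDiff 𝓘(ℂ, Cn m) 𝓘(ℂ, Cn n) ω f) (hl : l ≤ m) (hK : 0 ≤ K)
    (hκ : 0 < κ) (hg : g.SecondRicciGE l (-K)) (hh : h.RealBisectionalLE (-κ)) (x : M) :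
    sigma g h f l x ≤ l * K / κ := by
  obtain ⟨u, hu, hsigma⟩ := exists_isUnitary_sigma_eq g h f hl x
  rw [hsigma, ← Complex.re_sum]
  exact trace_gram_pullInner_le hf hl hK hκ hg hh hu

end SchwarzLemma

end HermitianGeometry

end

theorem theorem1p3_general {m n : ℕ} {M N : Type*}
    [TopologicalSpace M] [CompactSpace M]
    [ChartedSpace (HermitianGeometry.Cn m) M]
    [IsManifold 𝓘(ℂ, HermitianGeometry.Cn m) ω M]
    [TopologicalSpace N]
    [ChartedSpace (HermitianGeometry.Cn n) N]
    [IsManifold 𝓘(ℂ, HermitianGeometry.Cn n) ω N]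
    (g : HermitianGeometry.HermitianMetric m M) (h : HermitianGeometry.HermitianMetric n N)
    (f : M → N)
    (hf : ContMDiff 𝓘(ℂ, HermitianGeometry.Cn m) 𝓘(ℂ, HermitianGeometry.Cn n) ω f) :
    (∀ K κ : ℝ, 0 ≤ K → 0 < κ →
      (∀ x, -K ≤ g.chernScalar x) → h.FirstRicciLE m (-κ) →
      ∀ x, HermitianGeometry.volumeRatio g h f x ≤ (K / (m * κ)) ^ m) ∧
    (∀ l : ℕ, l ≤ m → ∀ K κ : ℝ, 0 ≤ K → 0 < κ →
      g.LScalarGE l (-K) → h.FirstRicciLE l (-κ) →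
      ∀ x, HermitianGeometry.wedgeMapNorm g h f l x ^ 2 ≤ (K / (l * κ)) ^ l) ∧
    (∀ l : ℕ, l ≤ m → ∀ K κ : ℝ, 0 ≤ K → 0 < κ →
      g.SecondRicciGE l (-K) → h.RealBisectionalLE (-κ) →
      ∀ x, HermitianGeometry.sigma g h f l x ≤ l * K / κ) :=
  ⟨fun _ _ hK hκ hg hh => HermitianGeometry.volumeRatio_le hf hK hκ hg hh,
    fun _ hl _ _ hK hκ hg hh => HermitianGeometry.wedgeMapNorm_sq_le hf hl hK hκ hg hh,
    fun _ hl _ _ hK hκ hg hh => HermitianGeometry.sigma_le hf hl hK hκ hg hh⟩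

theorem theorem1p3 {m n : ℕ} {M N : Type*}
    [TopologicalSpace M] [T2Space M] [CompactSpace M]
    [ChartedSpace (HermitianGeometry.Cn m) M]
    [IsManifold 𝓘(ℂ, HermitianGeometry.Cn m) ω M]
    [TopologicalSpace N] [T2Space N]
    [ChartedSpace (HermitianGeometry.Cn n) N]
    [IsManifold 𝓘(ℂ, HermitianGeometry.Cn n) ω N]
    (g : HermitianGeometry.HermitianMetric m M) (h : HermitianGeometry.HermitianMetric n N)
    (f : M → N)
    (hf : ContMDiff 𝓘(ℂ, HermitianGeometry.Cn m) 𝓘(ℂ, HermitianGeometry.Cn n) ω f)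
    (hmn : m ≤ n) :
    (∀ K κ : ℝ, 0 ≤ K → 0 < κ →
      (∀ x, -K ≤ g.chernScalar x) → h.FirstRicciLE m (-κ) →
      ∀ x, HermitianGeometry.volumeRatio g h f x ≤ (K / (m * κ)) ^ m) ∧
    (∀ l : ℕ, 1 ≤ l → l < m → g.IsKahler → ∀ K κ : ℝ, 0 ≤ K → 0 < κ →
      g.LScalarGE l (-K) → h.FirstRicciLE l (-κ) →
      ∀ x, HermitianGeometry.wedgeMapNorm g h f l x ^ 2 ≤ (K / (l * κ)) ^ l) ∧
    (∀ l : ℕ, 1 ≤ l → l ≤ m → ∀ K κ : ℝ, 0 ≤ K → 0 < κ →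
      g.SecondRicciGE l (-K) → h.RealBisectionalLE (-κ) →
      ∀ x, HermitianGeometry.sigma g h f l x ≤ l * K / κ) := by
  obtain ⟨ha, hb, hc⟩ := theorem1p3_general g h f hf
  exact ⟨ha, fun l _ hl _ => hb l hl.le, fun l _ => hc l⟩
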